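/- **Setting.** Let $d\ge 1$, let $(p_t)_{t\in\mathbb{R}}$ be probability measures on a measurable space $\mathcal X$, let $\Theta\subset\mathbb{R}^d$, and let $P_\theta=p_{\theta_1}\times\cdots\times p_{\theta_d}$ for $\theta\in\Theta$ (only the $p_t$ with $t$ a coordinate of some $\theta\in\Theta$ matter). Let $\theta_0=(t_0,\dots,t_0)$ be an interior point of $\Theta$, so that $P_{\theta_0}=p_{t_0}^{\otimes d}$. Let $s_0$ and $I_0=\mathbb{E}_{p_{t_0}}[s_0(X)^2]$ be the score function and the Fisher information of the one-dimensional model $(p_t)$ at $t_0$, where the score of a model is the function appearing in its differentiability in quadratic mean (the model is differentiable in quadratic mean at $\theta_0$ with score $S\in L^2(P_{\theta_0})$ if, for measures $\mu$ dominating $P_\theta$ and $P_{\theta_0}$, with densities $f_\theta,f_{\theta_0}$, one has $\int(\sqrt{f_\theta}-\sqrt{f_{\theta_0}}-\tfrac12(\theta-\theta_0)^TS\sqrt{f_{\theta_0}})^2d\mu=o(\|\theta-\theta_0\|^2)$ as $\theta\to\theta_0$). Fix constants $\delta_0,c_0,\rho>0$ and assume: 1. $(P_\theta)_{\theta\in\Theta}$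 is differentiable in quadratic mean at $\theta_0$ with score $S_{\theta_0}$ and non-singular Fisher information matrix $I(\theta_0)=\mathbb{E}_{P_{\theta_0}}[S_{\theta_0}S_{\theta_0}^T]$. 2. Let $B$ be the largest diagonal element of $I(\theta_0)$. For every $\delta>0$ with $\theta_0+\delta[-1,1]^d\subset\Theta$ and $\delta<\delta_0(B^2d)^{-1/4}$, one has $P_{\theta_0+\delta u}\ll P_{\theta_0}$ for all $u\in\{\pm1\}^d$, and $$\mathbb{E}\left[\left(\mathbb{E}_U\Big(\tfrac{dP_{\theta_0+\delta U}}{dP_{\theta_0}}(X)-1\Big)\Big(\tfrac{dP_{\theta_0+\delta U}}{dP_{\theta_0}}(X')-1\Big)-\delta^2S_{\theta_0}(X)^TS_{\theta_0}(X')\right)^2\right]\le(c_0\delta^4B^2d)^2,$$ where $X,X'\sim P_{\theta_0}$ are independent and $U$ is uniform on $\{\pm1\}^d$. 3. $\theta_0+\frac{\rho}{\sqrt{dI_0}}[-1,1]^d\subset\Theta$ (for some $\rho>0$ this holds because $\theta_0$ is an interior point). **Protocols.** Sensors $1,\dots,n$ observe $X_1,\dots,X_n\overset{\text{i.i.d.}}{\sim}P_\theta$,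 one each. A blackboard protocol with $k$ bits per sensor is, given public randomness $R$ independent of the observations, a complete binary tree of depth $nk$; each internal node $v$ carries a label $l_v\in\{1,\dots,n\}$ and a binary function $a_v$, and sensor $l_v$ writes the publicly visible bit $a_v(X_{l_v})$ when the protocol is at $v$, which selects the next node. Each path from the root to a leaf visits exactly $k$ internal nodes with label $i$, for each $i$. The transcript $Y\in\{0,1\}^{nk}$ is the sequence of all bits written. An estimator $\hat\theta$ is a function of $Y$ and of the public randomness with values in $\mathbb{R}^d$. **Theorem 1 (General lower bound).** Under these conditions $\mathsf{Var}_{p_{t_0}}(s_0(X))=I_0$, and for all $k\in\mathbb{N}$ and all $n\ge\frac{d^2}{2^k\wedge d}$, $$\inf_{\Pi_{\mathsf{BB}}}\inf_{\hat\theta}\sup_{\theta\in\Theta}\mathbb{E}_\theta\|\hat\theta-\theta\|_2^2\ \ge\ C\cdot\frac{d^2}{n(2^k\wedge d)\,\mathsf{Var}_{p_{t_0}}(s_0(X))}=C\cdot\frac{d^2}{n(2^k\wedge d)\,I_0},$$ where the infima are over all blackboard protocols with $k$ bits per sensor and all estimators, and the constant $C>0$ depends only on $\delta_0$, $c_0$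 and $\rho$; in particular it does not depend on $n$, $d$, $k$, $I_0$ or on the model. -/

import Mathlib

open MeasureTheory Filter Topology
open scoped ENNReal

universe v w

noncomputable section

/-- Differentiability in quadratic mean at `θ₀` of a statistical model `(P θ)`, `θ ∈ Θ`, with score
function `S` (Le Cam's form). With `h = θ - θ₀` and any measure dominating `P θ` and `P θ₀`, the sum
of the two terms on the left is `∫ (√f_θ - √f_θ₀ - ½ ⟨h, S⟩ √f_θ₀)²`, where `f_θ`, `f_θ₀` are the
densities: the first term is the part of the integral over `{f_θ₀ > 0}`, the second the part over
`{f_θ₀ = 0}`. The sum is required to be `o(‖h‖²)`. -/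
def DiffInQuadraticMean {E : Type*} [NormedAddCommGroup E] [InnerProductSpace ℝ E]
    {Ω : Type*} [MeasurableSpace Ω] (P : E → Measure Ω) (Θ : Set E) (θ₀ : E) (S : Ω → E) : Prop :=
  MemLp S 2 (P θ₀) ∧
  ∀ ε : ℝ, 0 < ε → ∀ᶠ θ in 𝓝[Θ] θ₀,
    (∫⁻ x, ENNReal.ofReal
        ((√(((P θ).rnDeriv (P θ₀) x).toReal) - 1 - (1 / 2) * inner ℝ (θ - θ₀) (S x)) ^ 2) ∂(P θ₀))
      + (P θ).singularPart (P θ₀) Set.univ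
    ≤ ENNReal.ofReal (ε * ‖θ - θ₀‖ ^ 2)

/-- The Fisher information of a one-parameter model with score `s` under the law `μ`. -/
def fisherInfo {X : Type*} [MeasurableSpace X] (μ : Measure X) (s : X → ℝ) : ℝ :=
  ∫ x, s x ^ 2 ∂μ

/-- The Fisher information matrix `E[S Sᵀ]` of a `d`-parameter model with score `S`. -/
def fisherMatrix {d : ℕ} {Ω : Type*} [MeasurableSpace Ω] (μ : Measure Ω)
    (S : Ω → EuclideanSpace ℝ (Fin d)) : Matrix (Fin d) (Fin d) ℝ :=
  Matrix.of fun i j => ∫ x, S x i * S x j ∂μ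

/-- The cube `θ₀ + δ [-1, 1]^d`. -/
def cube {d : ℕ} (θ₀ : EuclideanSpace ℝ (Fin d)) (δ : ℝ) : Set (EuclideanSpace ℝ (Fin d)) :=
  {θ | ∀ i, |θ i - θ₀ i| ≤ δ}

/-- The vector of `{-1, 1}^d` given by a family of signs. -/
def signVec {d : ℕ} (u : Fin d → ℤˣ) : EuclideanSpace ℝ (Fin d) :=
  WithLp.toLp 2 fun i => ((u i : ℤ) : ℝ)

/-- `E_U (dP_{θ₀+δU}/dP_{θ₀}(x) - 1) (dP_{θ₀+δU}/dP_{θ₀}(x') - 1) - δ² S(x)ᵀ S(x')`, where `U` is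
uniform on `{-1, 1}^d`. -/
def likelihoodRemainder {d : ℕ} {Ω : Type*} [MeasurableSpace Ω]
    (P : EuclideanSpace ℝ (Fin d) → Measure Ω) (θ₀ : EuclideanSpace ℝ (Fin d))
    (S : Ω → EuclideanSpace ℝ (Fin d)) (δ : ℝ) (x x' : Ω) : ℝ :=
  ((2 : ℝ) ^ d)⁻¹ * (∑ u : Fin d → ℤˣ,
      (((P (θ₀ + δ • signVec u)).rnDeriv (P θ₀) x).toReal - 1) *
      (((P (θ₀ + δ • signVec u)).rnDeriv (P θ₀) x').toReal - 1))
    - δ ^ 2 * inner ℝ (S x) (S x')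

/-- The second-order remainder bound with constants `δ₀`, `c₀`: for every `δ > 0` with
`θ₀ + δ [-1,1]^d ⊆ Θ` and `δ < δ₀ (B² d)^{-1/4}`, the likelihood ratios `dP_{θ₀+δu}/dP_{θ₀}` exist
and the remainder has second moment at most `(c₀ δ⁴ B² d)²` for independent `X, X' ∼ P_{θ₀}`.
Here `B` is the largest diagonal entry of the Fisher information matrix. -/
def RemainderBound {d : ℕ} {Ω : Type*} [MeasurableSpace Ω]
    (P : EuclideanSpace ℝ (Fin d) → Measure Ω) (Θ : Set (EuclideanSpace ℝ (Fin d)))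
    (θ₀ : EuclideanSpace ℝ (Fin d)) (S : Ω → EuclideanSpace ℝ (Fin d)) (δ₀ c₀ : ℝ) : Prop :=
  ∀ B : ℝ, B = (⨆ i, fisherMatrix (P θ₀) S i i) →
  ∀ δ : ℝ, 0 < δ → cube θ₀ δ ⊆ Θ → δ < δ₀ * (B ^ 2 * d) ^ (-(1 / 4) : ℝ) →
    (∀ u : Fin d → ℤˣ, P (θ₀ + δ • signVec u) ≪ P θ₀) ∧
    ∫⁻ z : Ω × Ω, ENNReal.ofReal (likelihoodRemainder P θ₀ S δ z.1 z.2 ^ 2) ∂((P θ₀).prod (P θ₀))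
      ≤ ENNReal.ofReal ((c₀ * δ ^ 4 * B ^ 2 * d) ^ 2)

/-- A blackboard protocol with public randomness for `n` sensors, each observing a point of `Ω` and
writing `k` bits. Given the public randomness `r` it is a complete binary tree of depth `n * k`,
whose nodes are the lists of bits written so far, in chronological order. At the node `v` the
sensor `label r v` writes the bit `bit r v x`, where `x` is its own observation. Along each path
from the root to a leaf every sensor writes exactly `k` bits. -/
structure BlackboardProtocol (Ω : Type v) [MeasurableSpace Ω] (n k : ℕ) :
    Type (max v (w + 1)) where
  Rand : Type w
  [randMeasurableSpace : MeasurableSpace Rand]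
  law : Measure Rand
  [law_isProb : IsProbabilityMeasure law]
  label : Rand → List Bool → Fin n
  bit : Rand → List Bool → Ω → Bool
  measurable_label : ∀ v, Measurable fun r => label r v
  measurable_bit : ∀ v, Measurable fun q : Rand × Ω => bit q.1 v q.2
  budget : ∀ (r : Rand) (y : List Bool), y.length = n * k → ∀ i : Fin n,
    ((Finset.range (n * k)).filter fun t => label r (y.take t) = i).card = k

attribute [instance] BlackboardProtocol.randMeasurableSpace BlackboardProtocol.law_isProb

namespace BlackboardProtocol

variable {Ω : Type v} [MeasurableSpace Ω] {n k : ℕ}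

/-- The content of the blackboard after `t` steps, for the public randomness `r` and the
observations `x`. -/
def board (pr : BlackboardProtocol.{v, w} Ω n k) (r : pr.Rand) (x : Fin n → Ω) : ℕ → List Bool
  | 0 => []
  | t + 1 => board pr r x t ++ [pr.bit r (board pr r x t) (x (pr.label r (board pr r x t)))]

/-- The final transcript, a list of `n * k` bits. -/
def transcript (pr : BlackboardProtocol.{v, w} Ω n k) (r : pr.Rand) (x : Fin n → Ω) : List Bool :=
  pr.board r x (n * k)

/-- The squared `ℓ²` risk at `θ` of the estimator `θhat` (a function of the public randomness and of
the transcript) when the `n` observations are i.i.d. with law `P θ` and independent of the public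
randomness. -/
def risk {d : ℕ} (pr : BlackboardProtocol.{v, w} Ω n k)
    (P : EuclideanSpace ℝ (Fin d) → Measure Ω)
    (θhat : pr.Rand → List Bool → EuclideanSpace ℝ (Fin d)) (θ : EuclideanSpace ℝ (Fin d)) : ℝ≥0∞ :=
  ∫⁻ q, ‖θhat q.1 (pr.transcript q.1 q.2) - θ‖ₑ ^ 2 ∂(pr.law.prod (Measure.pi fun _ : Fin n => P θ))

end BlackboardProtocol

/-- The minimax squared `ℓ²` risk over all blackboard protocols with `n` sensors and `k` bits per
sensor and all estimators. -/
def minimaxRisk {d : ℕ} {Ω : Type v} [MeasurableSpace Ω] (n k : ℕ)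
    (P : EuclideanSpace ℝ (Fin d) → Measure Ω) (Θ : Set (EuclideanSpace ℝ (Fin d))) : ℝ≥0∞ :=
  ⨅ (pr : BlackboardProtocol.{v, w} Ω n k)
    (θhat : pr.Rand → List Bool → EuclideanSpace ℝ (Fin d))
    (_ : ∀ y, Measurable fun r => θhat r y),
    ⨆ θ ∈ Θ, pr.risk P θhat θ

/-- The product model `P_θ = p_{θ₁} × ⋯ × p_{θ_d}`. -/
def productModel {X : Type v} [MeasurableSpace X] (p : ℝ → Measure X) (d : ℕ)
    (θ : EuclideanSpace ℝ (Fin d)) : Measure (Fin d → X) :=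
  Measure.pi fun i => p (θ i)

/-- The vector `(t₀, …, t₀)`. -/
def constVec (d : ℕ) (t₀ : ℝ) : EuclideanSpace ℝ (Fin d) :=
  WithLp.toLp 2 fun _ => t₀

end

/-!
The lower bound is Assouad's method over the hypercube of parameters whose coordinates are `t₀` or
`t₀ + δ`, where `δ² ≍ d / (n m I₀)` with `m = min (2 ^ k) d`. Putting one of the two values at
the centre `t₀` itself means that raising a single coordinate `j` from `t₀` to `t₀ + δ` changes the
law of an observation by the likelihood ratio `ℓ (x j)` of `p (t₀ + δ)` and `p t₀`, and only the
`χ²` distance `κ = E (ℓ - 1)²` of these two laws is needed.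

*The `χ²` bound* (`centredRatio_memLp_and_integral_sq_le`). Testing the remainder hypothesis against
`g(x j) g(x' j)`, with `g` a truncation of `ℓ - 1`, gives `κ ≤ 2 (δ² I₀ + c₀ δ⁴ B² d)`. This uses
that the score of the product model at `x` has the coordinates `s₀ (x i)`, by uniqueness of the
derivative in quadratic mean (`DiffInQuadraticMean.score_ae_eq`), that `s₀` is centred
(`DiffInQuadraticMean.integral_score_eq_zero`), and hence that `B = I₀`.

*The information bound* (`sum_sum_prod_mul_sq_le`). For a fixed value of the public randomness the
probability of a transcript `y` is a product over the sensors `i` of the probabilities of the sets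
`A i y` of observations that answer as in `y`. Under a vertex `u` of the hypercube the functions
`ℓ (x j) - 1`, for the `j` still at `t₀`, are orthogonal with squared norm at most `κ`. Let `r` be
the ratio of the probabilities of `A i y` after and before raising the coordinate `j`. For each
sensor `i`, the sum over `j` of the expectations of `(r - 1)²` is at most `κ 2 ^ k` by Bessel's
inequality, since the weights `∏ P(A i' y)` without the factor of sensor `i` add up to `2 ^ k`, and
at most `κ d` by the Cauchy–Schwarz inequality.

*The affinity bound* (`quarter_sub_le_sum_min_prod`). Interaction between the sensors is harmless
because every mixture of the two families of factors is again the law of a transcript. Hence under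
the first law the ratios of the different sensors have mean one and are uncorrelated, and
Chebyshev's inequality for their sum bounds the affinity of the two laws of the transcript below by
`1 / 4 - 2 V`, where `V` is the sum over the sensors of the expectations of `(r - 1)²`.

Together, if `n κ m ≤ d / 32`, the mean risk over the vertices is at least `δ² d / 32`. With
`δ² = a d / (n m I₀)` and `a` small in terms of `δ₀`, `c₀` and `ρ`, the condition `n m ≥ d²` makes
the term `c₀ δ⁴ I₀² d` of `κ` at most of the order `d / (n m)` of `δ² I₀`, and keeps the hypercube
in `Θ` and in the range of the remainder hypothesis.
-/

/-! ### Affinity of product weights -/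

theorem sub_one_sub_two_mul_sq_le_log {r : ℝ} (hr : 1 / 2 ≤ r) (hr' : r ≤ 3 / 2) :
    (r - 1) - 2 * (r - 1) ^ 2 ≤ Real.log r := by
  have hx : |1 - r| ≤ 1 / 2 := abs_le.2 ⟨by linarith, by linarith⟩
  have h := Real.abs_log_sub_add_sum_range_le (x := 1 - r) (by linarith) 1
  simp only [Finset.range_one, Finset.sum_singleton, Nat.cast_zero, zero_add, pow_one, div_one,
    sub_sub_cancel] at h
  have h2 : |1 - r| ^ (1 + 1) / (1 - |1 - r|) ≤ 2 * (r - 1) ^ 2 := by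
    rw [div_le_iff₀ (by linarith), show 1 + 1 = 2 from rfl, sq_abs]
    nlinarith [sq_nonneg (r - 1), sq_nonneg (1 - r)]
  have h3 := (abs_le.1 (h.trans h2)).1
  linarith

/-- If `∑ (r i - 1)²` and `(∑ (r i - 1))²` are at most `1 / 4`, expanding the logarithm to second
order gives `∏ r i ≥ e⁻¹ ≥ 1 / 4`; otherwise the left-hand side is not positive. -/
theorem quarter_sub_le_min_one_prod {ι : Type*} [Fintype ι] (r : ι → ℝ) (hr : ∀ i, 0 ≤ r i) :
    1 / 4 - ∑ i, (r i - 1) ^ 2 - (∑ i, (r i - 1)) ^ 2 ≤ min 1 (∏ i, r i) := by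
  have hV : 0 ≤ ∑ i, (r i - 1) ^ 2 := Finset.sum_nonneg fun i _ => sq_nonneg _
  have hW : 0 ≤ (∑ i, (r i - 1)) ^ 2 := sq_nonneg _
  have hZ : 0 ≤ ∏ i, r i := Finset.prod_nonneg fun i _ => hr i
  rcases le_or_gt (∑ i, (r i - 1) ^ 2) (1 / 4) with h1 | h1
  swap
  · exact le_min (by linarith) (by linarith)
  rcases le_or_gt ((∑ i, (r i - 1)) ^ 2) (1 / 4) with h2 | h2
  swap
  · exact le_min (by linarith) (by linarith)
  refine le_min (by linarith) ?_
  have hi : ∀ i, |r i - 1| ≤ 1 / 2 := fun i => by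
    have : (r i - 1) ^ 2 ≤ ∑ i, (r i - 1) ^ 2 :=
      Finset.single_le_sum (f := fun i => (r i - 1) ^ 2) (fun i _ => sq_nonneg _)
        (Finset.mem_univ i)
    exact abs_le_of_sq_le_sq (by linarith) (by norm_num)
  have hpos : ∀ i, 0 < r i := fun i => by linarith [(abs_le.1 (hi i)).1]
  have hlog : ∑ i, ((r i - 1) - 2 * (r i - 1) ^ 2) ≤ Real.log (∏ i, r i) := by
    rw [Real.log_prod fun i _ => (hpos i).ne']
    exact Finset.sum_le_sum fun i _ => sub_one_sub_two_mul_sq_le_log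
      (by linarith [(abs_le.1 (hi i)).1]) (by linarith [(abs_le.1 (hi i)).2])
  rw [Finset.sum_sub_distrib, ← Finset.mul_sum] at hlog
  have hW' : -(1 / 2) ≤ ∑ i, (r i - 1) :=
    (abs_le.1 (abs_le_of_sq_le_sq (a := ∑ i, (r i - 1)) (b := 1 / 2) (by linarith)
      (by norm_num))).1
  have h3 : -1 ≤ Real.log (∏ i, r i) := by linarith
  have h4 := Real.exp_le_exp.2 h3
  rw [Real.exp_log (Finset.prod_pos fun i _ => hpos i)] at h4
  have h5 : 1 / 4 ≤ Real.exp (-1) := by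
    rw [Real.exp_neg, one_div]
    exact inv_anti₀ (Real.exp_pos 1) (by linarith [Real.exp_one_lt_d9])
  linarith

/-- **Affinity bound.** Let `a i`, `b i` be weights such that every mixed product
`∏ (a i or b i)` is a probability on `Y`. Under the probability `∏ a i` the ratios `b i / a i - 1`
are centred and pairwise uncorrelated, so the affinity of `∏ a i` and `∏ b i` is controlled by the
sum of the individual `χ²` terms, without any bound on the ratios. -/
theorem quarter_sub_le_sum_min_prod {n : ℕ} {Y : Type*} [Fintype Y] (a b : Fin n → Y → ℝ)
    (ha : ∀ i y, 0 ≤ a i y) (hb : ∀ i y, 0 ≤ b i y) (hab : ∀ i y, a i y = 0 → b i y = 0)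
    (hmix : ∀ c : Fin n → Prop, ∀ [DecidablePred c],
      ∑ y, ∏ i, (if c i then b i y else a i y) = 1) :
    1 / 4 - 2 * ∑ i, ∑ y, (∏ i', a i' y) * (b i y / a i y - 1) ^ 2 ≤
      ∑ y, min (∏ i, a i y) (∏ i, b i y) := by
  classical
  set r : Fin n → Y → ℝ := fun i y => b i y / a i y with hrdef
  set A : Y → ℝ := fun y => ∏ i, a i y with hA
  have hA0 : ∀ y, 0 ≤ A y := fun y => Finset.prod_nonneg fun i _ => ha i y
  have har : ∀ i y, a i y * r i y = b i y := fun i y => by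
    by_cases h : a i y = 0
    · simp [h, hab i y h]
    · simp only [hrdef]; field_simp
  have hAr : ∀ (T : Finset (Fin n)) y, A y * ∏ i ∈ T, r i y =
      ∏ i, (if i ∈ T then b i y else a i y) := fun T y => by
    have : ∏ i ∈ T, r i y = ∏ i, (if i ∈ T then r i y else 1) := by
      rw [Finset.prod_ite_mem, Finset.univ_inter]
    rw [this, hA, ← Finset.prod_mul_distrib]
    refine Finset.prod_congr rfl fun i _ => ?_
    split_ifs
    · exact har i y
    · exact mul_one _
  have hE : ∀ T : Finset (Fin n), ∑ y, A y * ∏ i ∈ T, r i y = 1 := fun T => by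
    simp_rw [hAr T]; exact hmix (· ∈ T)
  have hE0 : ∑ y, A y = 1 := by simpa using hE ∅
  have hE1 : ∀ i, ∑ y, A y * r i y = 1 := fun i => by simpa using hE {i}
  have hE2 : ∀ i j, i ≠ j → ∑ y, A y * (r i y * r j y) = 1 := fun i j hij => by
    simpa [Finset.prod_pair hij] using hE {i, j}
  have hcov : ∀ i j, i ≠ j → ∑ y, A y * ((r i y - 1) * (r j y - 1)) = 0 := fun i j hij => by
    have : ∀ y, A y * ((r i y - 1) * (r j y - 1)) =
        A y * (r i y * r j y) - A y * r i y - A y * r j y + A y := fun y => by ring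
    simp_rw [this, Finset.sum_add_distrib, Finset.sum_sub_distrib, hE1, hE2 i j hij, hE0]
    norm_num
  have hW : ∑ y, A y * (∑ i, (r i y - 1)) ^ 2 = ∑ i, ∑ y, A y * (r i y - 1) ^ 2 := by
    have : ∀ y, A y * (∑ i, (r i y - 1)) ^ 2 =
        ∑ i, ∑ j, A y * ((r i y - 1) * (r j y - 1)) := fun y => by
      rw [sq, Finset.sum_mul_sum, Finset.mul_sum]
      exact Finset.sum_congr rfl fun i _ => Finset.mul_sum _ _ _
    simp_rw [this]
    rw [Finset.sum_comm]
    refine Finset.sum_congr rfl fun i _ => ?_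
    rw [Finset.sum_comm, Finset.sum_eq_single i]
    · exact Finset.sum_congr rfl fun y _ => by ring
    · exact fun j _ hj => hcov i j hj.symm
    · simp
  have hB : ∀ y, ∏ i, b i y = A y * ∏ i, r i y := fun y => by
    rw [hA, ← Finset.prod_mul_distrib]; exact Finset.prod_congr rfl fun i _ => (har i y).symm
  calc 1 / 4 - 2 * ∑ i, ∑ y, A y * (r i y - 1) ^ 2
      = ∑ y, A y * (1 / 4 - ∑ i, (r i y - 1) ^ 2 - (∑ i, (r i y - 1)) ^ 2) := by
        have hV : ∑ y, A y * ∑ i, (r i y - 1) ^ 2 = ∑ i, ∑ y, A y * (r i y - 1) ^ 2 := by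
          simp_rw [Finset.mul_sum]; exact Finset.sum_comm
        have hy : ∀ y, A y * (1 / 4 - ∑ i, (r i y - 1) ^ 2 - (∑ i, (r i y - 1)) ^ 2) =
            A y * (1 / 4) - A y * ∑ i, (r i y - 1) ^ 2 - A y * (∑ i, (r i y - 1)) ^ 2 :=
          fun y => by ring
        rw [Finset.sum_congr rfl fun y _ => hy y, Finset.sum_sub_distrib, Finset.sum_sub_distrib,
          ← Finset.sum_mul, hE0, hW, hV]
        ring
    _ ≤ ∑ y, min (A y) (∏ i, b i y) := by
        refine Finset.sum_le_sum fun y _ => ?_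
        have hmin : min (A y) (A y * ∏ i, r i y) = A y * min 1 (∏ i, r i y) := by
          rw [mul_min_of_nonneg _ _ (hA0 y), mul_one]
        rw [hB, hmin]
        exact mul_le_mul_of_nonneg_left (quarter_sub_le_min_one_prod _
          fun i => div_nonneg (hb i y) (ha i y)) (hA0 y)

/-! ### Deterministic protocol trees -/

/-- In a binary tree whose nodes are lists of bits, let each `F i` be a weight on the nodes that is
unchanged from a node to its children unless the node is labelled `i`, and is split between
the two children if it is. Then the products `∏ F i` over the nodes of a given depth add up to
their value at the root. -/
theorem sum_prod_ofFn_eq_prod_nil {n : ℕ} (label : List Bool → Fin n)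
    (F : Fin n → List Bool → ℝ)
    (hne : ∀ y i b, label y ≠ i → F i (y ++ [b]) = F i y)
    (heq : ∀ y, F (label y) (y ++ [true]) + F (label y) (y ++ [false]) = F (label y) y) (N : ℕ) :
    ∑ y : Fin N → Bool, ∏ i, F i (List.ofFn y) = ∏ i, F i [] := by
  induction N with
  | zero => simp
  | succ N ih =>
    rw [← ih, ← (Fin.snocEquiv fun _ : Fin (N + 1) => Bool).sum_comp, Fintype.sum_prod_type_right]
    refine Finset.sum_congr rfl fun y _ => ?_
    have hsnoc : ∀ b : Bool, List.ofFn (Fin.snocEquiv (fun _ : Fin (N + 1) => Bool) (b, y)) =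
        List.ofFn y ++ [b] := fun b => by
      rw [List.ofFn_succ', List.concat_eq_append]
      simp [Fin.snocEquiv]
    have hsplit : ∀ l : List Bool, ∏ i, F i l =
        F (label (List.ofFn y)) l * ∏ i ∈ Finset.univ.erase (label (List.ofFn y)), F i l :=
      fun l => (Finset.mul_prod_erase _ _ (Finset.mem_univ _)).symm
    have herase : ∀ b, ∏ i ∈ Finset.univ.erase (label (List.ofFn y)), F i (List.ofFn y ++ [b]) =
        ∏ i ∈ Finset.univ.erase (label (List.ofFn y)), F i (List.ofFn y) := fun b =>
      Finset.prod_congr rfl fun i hi => hne _ _ _ (Finset.ne_of_mem_erase hi).symm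
    rw [Fintype.sum_bool, hsnoc, hsnoc, hsplit, hsplit (_ ++ [false]), herase, herase, ← add_mul,
      heq, ← hsplit]

/-- The observations of sensor `i` for which all bits that `i` writes along the path `y` are
those of `y`. The nodes on the path are the prefixes of `y`. -/
def answerSet {Ω : Type*} {n : ℕ} (label : List Bool → Fin n) (bit : List Bool → Ω → Bool)
    (i : Fin n) (y : List Bool) : Set Ω :=
  {x | ∀ t < y.length, label (y.take t) = i → y[t]? = some (bit (y.take t) x)}

section Tree

variable {Ω : Type*} {n : ℕ} (label : List Bool → Fin n) (bit : List Bool → Ω → Bool)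

theorem mem_answerSet_append {i : Fin n} {y : List Bool} {b : Bool} {x : Ω} :
    x ∈ answerSet label bit i (y ++ [b]) ↔
      x ∈ answerSet label bit i y ∧ (label y = i → bit y x = b) := by
  simp only [answerSet, Set.mem_ofPred_eq, List.length_append, List.length_singleton]
  constructor
  · intro h
    refine ⟨fun t ht hl => ?_, fun hl => ?_⟩
    · have := h t (by omega)
      rw [List.take_append_of_le_length ht.le, List.getElem?_append_left ht] at this
      exact this hl
    · have := h y.length (by omega)
      rw [List.take_left, List.getElem?_append_right le_rfl] at this
      simpa using (this hl).symm
  · rintro ⟨h1, h2⟩ t ht hl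
    rcases Nat.lt_succ_iff_lt_or_eq.1 ht with ht' | rfl
    · rw [List.take_append_of_le_length ht'.le] at hl ⊢
      rw [List.getElem?_append_left ht']
      exact h1 t ht' hl
    · rw [List.take_left] at hl ⊢
      rw [List.getElem?_append_right le_rfl]
      simp [h2 hl]

theorem answerSet_nil (i : Fin n) : answerSet label bit i [] = Set.univ := by
  ext; simp [answerSet]

variable [MeasurableSpace Ω]

theorem measurableSet_answerSet (hbit : ∀ y, Measurable (bit y)) (i : Fin n) (y : List Bool) :
    MeasurableSet (answerSet label bit i y) := by
  simp only [answerSet, Set.ofPred_forall]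
  refine MeasurableSet.iInter fun t => MeasurableSet.iInter fun _ =>
    MeasurableSet.iInter fun _ => ?_
  have : {x | y[t]? = some (bit (y.take t) x)} = bit (y.take t) ⁻¹' {b | y[t]? = some b} := rfl
  rw [this]
  exact hbit _ (Set.to_countable _).measurableSet

theorem measureReal_answerSet_append_of_ne (μ : Measure Ω) {i : Fin n} {y : List Bool} (b : Bool)
    (h : label y ≠ i) :
    μ.real (answerSet label bit i (y ++ [b])) = μ.real (answerSet label bit i y) := by
  congr 1; ext x; simp [mem_answerSet_append, h]

theorem measureReal_answerSet_append_add (μ : Measure Ω) [IsFiniteMeasure μ]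
    (hbit : ∀ y, Measurable (bit y)) (y : List Bool) :
    μ.real (answerSet label bit (label y) (y ++ [true])) +
      μ.real (answerSet label bit (label y) (y ++ [false])) =
    μ.real (answerSet label bit (label y) y) := by
  have h1 : answerSet label bit (label y) (y ++ [true]) =
      answerSet label bit (label y) y ∩ bit y ⁻¹' {true} := by
    ext x; simp [mem_answerSet_append]
  have h2 : answerSet label bit (label y) (y ++ [false]) =
      answerSet label bit (label y) y \ bit y ⁻¹' {true} := by
    ext x; simp [mem_answerSet_append]
  rw [h1, h2]
  exact measureReal_inter_add_sdiff (hbit y (MeasurableSet.singleton _))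

theorem sum_prod_measureReal_answerSet (μ : Fin n → Measure Ω) [∀ i, IsFiniteMeasure (μ i)]
    (hbit : ∀ y, Measurable (bit y)) (N : ℕ) :
    ∑ y : Fin N → Bool, ∏ i, (μ i).real (answerSet label bit i (List.ofFn y)) =
      ∏ i, (μ i).real Set.univ := by
  rw [sum_prod_ofFn_eq_prod_nil label (fun i y => (μ i).real (answerSet label bit i y))
    (fun y i b h => measureReal_answerSet_append_of_ne label bit _ b h)
    (fun y => measureReal_answerSet_append_add label bit _ hbit y)]
  simp_rw [answerSet_nil]

/-- Leaving out the factor of a sensor that writes `k` bits leaves both values of each of these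
bits open, which accounts for the factor `2 ^ k`. -/
theorem sum_prod_erase_measureReal_answerSet (μ : Measure Ω) [IsProbabilityMeasure μ]
    (hbit : ∀ y, Measurable (bit y)) {N k : ℕ} (i : Fin n)
    (hk : ∀ y : List Bool, y.length = N →
      ((Finset.range N).filter fun t => label (y.take t) = i).card = k) :
    ∑ y : Fin N → Bool, ∏ i' ∈ Finset.univ.erase i,
      μ.real (answerSet label bit i' (List.ofFn y)) = 2 ^ k := by
  -- The omitted sensor is replaced by one that answers with fair coin flips.
  set c : List Bool → ℕ := fun y =>
    ((Finset.range y.length).filter fun t => label (y.take t) = i).card with hc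
  have hc' : ∀ y b, c (y ++ [b]) = c y + if label y = i then 1 else 0 := fun y b => by
    have : (Finset.range y.length).filter (fun t => label ((y ++ [b]).take t) = i) =
        (Finset.range y.length).filter (fun t => label (y.take t) = i) :=
      Finset.filter_congr fun t ht => by
        rw [List.take_append_of_le_length (Finset.mem_range.1 ht).le]
    simp only [hc, List.length_append, List.length_singleton, Finset.range_add_one,
      Finset.filter_insert, List.take_left, this]
    split_ifs with h
    · rw [Finset.card_insert_of_notMem (by simp)]
    · rfl
  have h := sum_prod_ofFn_eq_prod_nil label
    (fun i' y => if i' = i then ((2 : ℝ)⁻¹) ^ c y else μ.real (answerSet label bit i' y))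
    (fun y i' b h => by
      by_cases hi : i' = i
      · subst hi; simp [hc', h]
      · simp only [hi, if_false]; exact measureReal_answerSet_append_of_ne label bit _ b h)
    (fun y => by
      by_cases hi : label y = i
      · simp only [hc', hi, if_true, pow_succ]; ring
      · simp only [hi, if_false]; exact measureReal_answerSet_append_add label bit _ hbit y) N
  have hsplit : ∀ y : List Bool,
      ∏ i', (if i' = i then ((2 : ℝ)⁻¹) ^ c y else μ.real (answerSet label bit i' y)) =
      ((2 : ℝ)⁻¹) ^ c y * ∏ i' ∈ Finset.univ.erase i, μ.real (answerSet label bit i' y) :=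
    fun y => by
    rw [← Finset.mul_prod_erase _ _ (Finset.mem_univ i), if_pos rfl]
    congr 1
    exact Finset.prod_congr rfl fun j hj => if_neg (Finset.ne_of_mem_erase hj)
  have hck : ∀ y : Fin N → Bool, c (List.ofFn y) = k := fun y => by
    have := hk (List.ofFn y) (by simp)
    simpa [hc] using this
  simp_rw [hsplit, hck, ← Finset.mul_sum, answerSet_nil] at h
  have hnil : c [] = 0 := by simp [hc]
  rw [hnil] at h
  simp only [pow_zero, probReal_univ, Finset.prod_const_one, mul_one, inv_pow] at h
  rwa [inv_mul_eq_one₀ (by positivity), eq_comm] at h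

end Tree

/-! ### Product measures and orthogonal functions -/

theorem lintegral_pi_prod {ι : Type*} [Fintype ι] {X : Type*} [MeasurableSpace X]
    (μ : ι → Measure X) [∀ i, IsProbabilityMeasure (μ i)] (g : ι → X → ℝ≥0∞)
    (hg : ∀ i, Measurable (g i)) :
    ∫⁻ x, ∏ i, g i (x i) ∂Measure.pi μ = ∏ i, ∫⁻ x, g i x ∂μ i := by
  have hind := ProbabilityTheory.iIndepFun_pi (μ := μ) (X := g) fun i => (hg i).aemeasurable
  rw [ProbabilityTheory.lintegral_prod_eq_prod_lintegral_of_indepFun Finset.univ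
    (fun i (x : ι → X) => g i (x i)) hind fun i => (hg i).comp (measurable_pi_apply i)]
  exact Finset.prod_congr rfl fun i _ =>
    (measurePreserving_eval μ i).lintegral_comp (hg i)

/-- Changing one factor of a product measure by a density changes the product by the density of
that coordinate. -/
theorem pi_eq_withDensity_eval {ι : Type*} [Fintype ι] {X : Type*} [MeasurableSpace X]
    (μ ν : ι → Measure X) [∀ i, IsProbabilityMeasure (μ i)] [∀ i, IsProbabilityMeasure (ν i)]
    (j : ι) {f : X → ℝ≥0∞} (hf : Measurable f) (hj : ν j = (μ j).withDensity f)
    (hne : ∀ i, i ≠ j → ν i = μ i) :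
    Measure.pi ν = (Measure.pi μ).withDensity fun x => f (x j) := by
  classical
  refine Measure.pi_eq fun s hs => ?_
  rw [withDensity_apply _ (MeasurableSet.univ_pi hs),
    ← lintegral_indicator (MeasurableSet.univ_pi hs)]
  have h : ∀ x : ι → X, (Set.univ.pi s).indicator (fun x => f (x j)) x =
      ∏ i, (s i).indicator (if i = j then f else 1) (x i) := fun x => by
    by_cases hx : x ∈ Set.univ.pi s
    · have hx' : ∀ i, x i ∈ s i := fun i => hx i (Set.mem_univ i)
      rw [Set.indicator_of_mem hx, ← Finset.mul_prod_erase _ _ (Finset.mem_univ j),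
        Set.indicator_of_mem (hx' j), if_pos rfl, Finset.prod_eq_one, mul_one]
      intro i hi
      rw [Set.indicator_of_mem (hx' i), if_neg (Finset.ne_of_mem_erase hi), Pi.one_apply]
    · rw [Set.indicator_of_notMem hx]
      simp only [Set.mem_univ_pi, not_forall] at hx
      obtain ⟨i, hi⟩ := hx
      exact (Finset.prod_eq_zero (Finset.mem_univ i) (Set.indicator_of_notMem hi _)).symm
  simp_rw [h]
  rw [lintegral_pi_prod]
  · refine Finset.prod_congr rfl fun i _ => ?_
    rw [lintegral_indicator (hs i)]
    by_cases hi : i = j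
    · subst hi; rw [if_pos rfl, hj, withDensity_apply _ (hs i)]
    · rw [if_neg hi, hne i hi]; simp
  · intro i
    refine Measurable.indicator ?_ (hs i)
    split_ifs
    · exact hf
    · exact measurable_one

theorem integral_pi_mul_eval {ι : Type*} [Fintype ι] {X : Type*} [MeasurableSpace X]
    (μ : ι → Measure X) [∀ i, IsProbabilityMeasure (μ i)] {i j : ι} (hij : i ≠ j) {f g : X → ℝ}
    (hf : AEStronglyMeasurable f (μ i)) (hg : AEStronglyMeasurable g (μ j)) :
    ∫ x, f (x i) * g (x j) ∂Measure.pi μ = (∫ x, f x ∂μ i) * ∫ x, g x ∂μ j := by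
  have hind : ProbabilityTheory.iIndepFun (fun i (x : ι → X) => x i) (Measure.pi μ) :=
    ProbabilityTheory.iIndepFun_pi (X := fun _ => id) fun i => aemeasurable_id
  have hmp := fun i => measurePreserving_eval μ i
  rw [(hind.indepFun hij).integral_fun_comp_mul_comp (hmp i).aemeasurable (hmp j).aemeasurable
    ((hmp i).map_eq.symm ▸ hf) ((hmp j).map_eq.symm ▸ hg)]
  rw [integral_comp_eval (μ := μ) hf, integral_comp_eval (μ := μ) hg]

section Orthogonal

variable {Ω : Type*} [MeasurableSpace Ω] (μ : Measure Ω)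

theorem sq_integral_mul_le {f g : Ω → ℝ} (hf : MemLp f 2 μ) (hg : MemLp g 2 μ) :
    (∫ x, f x * g x ∂μ) ^ 2 ≤ (∫ x, f x ^ 2 ∂μ) * ∫ x, g x ^ 2 ∂μ := by
  have hfg : Integrable (fun x => f x * g x) μ := hf.integrable_mul hg
  -- The quadratic polynomial `t ↦ ∫ (t f - g)²` is nonnegative.
  have h : ∀ t : ℝ, 0 ≤ (∫ x, f x ^ 2 ∂μ) * (t * t) + (-2 * ∫ x, f x * g x ∂μ) * t +
      ∫ x, g x ^ 2 ∂μ := fun t => by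
    have h0 : 0 ≤ ∫ x, (t * f x - g x) ^ 2 ∂μ := integral_nonneg fun x => sq_nonneg _
    have : ∀ x, (t * f x - g x) ^ 2 = t * t * f x ^ 2 - 2 * t * (f x * g x) + g x ^ 2 :=
      fun x => by ring
    simp_rw [this] at h0
    have hsub : Integrable (fun x => t * t * f x ^ 2 - 2 * t * (f x * g x)) μ :=
      (hf.integrable_sq.const_mul _).sub (hfg.const_mul _)
    rw [integral_add hsub hg.integrable_sq, integral_sub (hf.integrable_sq.const_mul _)
      (hfg.const_mul _), integral_const_mul, integral_const_mul] at h0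
    linarith
  have := discrim_le_zero h
  rw [discrim] at this
  nlinarith

theorem sq_setIntegral_le [IsFiniteMeasure μ] {φ : Ω → ℝ} (hφ : MemLp φ 2 μ) (A : Set Ω) :
    (∫ x in A, φ x ∂μ) ^ 2 ≤ μ.real A * ∫ x in A, φ x ^ 2 ∂μ := by
  have := sq_integral_mul_le (μ.restrict A) (memLp_const (1 : ℝ)) (hφ.restrict A)
  simpa using this

/-- **Bessel's inequality** for orthogonal functions of squared norm at most `κ`, tested against
the indicator of `A`. -/
theorem sum_sq_setIntegral_le [IsFiniteMeasure μ] {ι : Type*} [Fintype ι] {φ : ι → Ω → ℝ} {κ : ℝ}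
    (hκ : 0 < κ) (hφ : ∀ j, MemLp (φ j) 2 μ)
    (horth : ∀ i j, i ≠ j → ∫ x, φ i x * φ j x ∂μ = 0) (hnorm : ∀ j, ∫ x, φ j x ^ 2 ∂μ ≤ κ)
    (A : Set Ω) :
    ∑ j, (∫ x in A, φ j x ∂μ) ^ 2 ≤ κ * μ.real A := by
  classical
  set c : ι → ℝ := fun j => ∫ x in A, φ j x ∂μ with hc
  set Φ : Ω → ℝ := fun x => ∑ j, c j * φ j x with hΦ
  have hΦ2 : MemLp Φ 2 μ := memLp_finsetSum _ fun j _ => (hφ j).const_mul (c j)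
  have hint : ∀ i j, Integrable (fun x => φ i x * φ j x) μ := fun i j =>
    (hφ i).integrable_mul (hφ j)
  have hsq : ∫ x, Φ x ^ 2 ∂μ ≤ κ * ∑ j, c j ^ 2 := by
    have h1 : ∀ x, Φ x ^ 2 = ∑ i, ∑ j, c i * c j * (φ i x * φ j x) := fun x => by
      rw [hΦ, sq, Finset.sum_mul_sum]
      exact Finset.sum_congr rfl fun i _ => Finset.sum_congr rfl fun j _ => by ring
    simp_rw [h1]
    rw [integral_finsetSum _ fun i _ => integrable_finsetSum _ fun j _ => (hint i j).const_mul _,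
      Finset.mul_sum]
    refine Finset.sum_le_sum fun i _ => ?_
    rw [integral_finsetSum _ fun j _ => (hint i j).const_mul _, Finset.sum_eq_single i]
    · rw [integral_const_mul]
      simp_rw [← sq]
      rw [mul_comm]
      exact mul_le_mul_of_nonneg_right (hnorm i) (sq_nonneg _)
    · intro j _ hj
      rw [integral_const_mul, horth i j hj.symm, mul_zero]
    · simp
  have hlin : ∫ x in A, Φ x ∂μ = ∑ j, c j ^ 2 := by
    rw [hΦ, integral_finsetSum _ fun j _ =>
      (((hφ j).integrable (by norm_num)).integrableOn).const_mul _]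
    refine Finset.sum_congr rfl fun j _ => ?_
    rw [integral_const_mul, sq]
  have hle := sq_setIntegral_le μ hΦ2 A
  rw [hlin] at hle
  have h2 : ∫ x in A, Φ x ^ 2 ∂μ ≤ κ * ∑ j, c j ^ 2 :=
    (setIntegral_le_integral hΦ2.integrable_sq (ae_of_all _ fun x => sq_nonneg _)).trans hsq
  have h3 : (∑ j, c j ^ 2) ^ 2 ≤ (κ * μ.real A) * ∑ j, c j ^ 2 := by
    nlinarith [mul_le_mul_of_nonneg_left h2 (measureReal_nonneg (μ := μ) (s := A))]
  rcases (Finset.sum_nonneg fun j (_ : j ∈ Finset.univ) => sq_nonneg (c j)).eq_or_lt with h | h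
  · rw [← h]; exact mul_nonneg hκ.le measureReal_nonneg
  · rw [sq] at h3
    exact le_of_mul_le_mul_right h3 h

/-- **Information bound for a protocol.** The total `χ²` information that the transcript carries
through sensor `i` about perturbations of its law `μ` in the orthogonal directions `φ j`. Bessel's
inequality gives the bound `κ 2 ^ k`, and the Cauchy–Schwarz inequality for each `j` separately the
bound `κ |ι|`. -/
theorem sum_sum_prod_mul_sq_le [IsProbabilityMeasure μ] {ι : Type*} [Fintype ι]
    {φ : ι → Ω → ℝ} {κ : ℝ} (hκ : 0 < κ) (hφ : ∀ j, MemLp (φ j) 2 μ)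
    (horth : ∀ i j, i ≠ j → ∫ x, φ i x * φ j x ∂μ = 0) (hnorm : ∀ j, ∫ x, φ j x ^ 2 ∂μ ≤ κ)
    {n N k : ℕ} (label : List Bool → Fin n) (bit : List Bool → Ω → Bool)
    (hbit : ∀ y, Measurable (bit y)) (i : Fin n)
    (hk : ∀ y : List Bool, y.length = N →
      ((Finset.range N).filter fun t => label (y.take t) = i).card = k) :
    ∑ j, ∑ y : Fin N → Bool, (∏ i', μ.real (answerSet label bit i' (List.ofFn y))) *
      ((∫ x in answerSet label bit i (List.ofFn y), φ j x ∂μ) /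
        μ.real (answerSet label bit i (List.ofFn y))) ^ 2 ≤
    κ * min ((2 : ℝ) ^ k) (Fintype.card ι) := by
  classical
  set A : Fin n → (Fin N → Bool) → Set Ω := fun i y => answerSet label bit i (List.ofFn y) with hA
  have hAm : ∀ i y, MeasurableSet (A i y) := fun i y => measurableSet_answerSet label bit hbit i _
  set R : (Fin N → Bool) → ℝ := fun y => ∏ i' ∈ Finset.univ.erase i, μ.real (A i' y) with hR
  have hR0 : ∀ y, 0 ≤ R y := fun y => Finset.prod_nonneg fun _ _ => measureReal_nonneg
  have hprod : ∀ y, ∏ i', μ.real (A i' y) = μ.real (A i y) * R y := fun y =>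
    (Finset.mul_prod_erase _ _ (Finset.mem_univ i)).symm
  change ∑ j, ∑ y, (∏ i', μ.real (A i' y)) * ((∫ x in A i y, φ j x ∂μ) / μ.real (A i y)) ^ 2 ≤ _
  rw [mul_min_of_nonneg _ _ hκ.le]
  refine le_min ?_ ?_
  · have hsum : ∑ y, R y = 2 ^ k := sum_prod_erase_measureReal_answerSet label bit μ hbit i hk
    rw [Finset.sum_comm, ← hsum, Finset.mul_sum]
    refine Finset.sum_le_sum fun y _ => ?_
    rw [← Finset.mul_sum, hprod]
    simp_rw [div_pow]
    rw [← Finset.sum_div]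
    have hB := sum_sq_setIntegral_le μ hκ hφ horth hnorm (A i y)
    rcases (measureReal_nonneg (μ := μ) (s := A i y)).eq_or_lt with h0 | h0
    · rw [← h0]; simpa using mul_nonneg hκ.le (hR0 y)
    · rw [mul_comm (μ.real _), mul_assoc, mul_comm κ]
      refine mul_le_mul_of_nonneg_left ?_ (hR0 y)
      rw [mul_div_assoc', div_le_iff₀ (by positivity)]
      nlinarith
  · have hj : ∀ j, ∑ y, (∏ i', μ.real (A i' y)) *
        ((∫ x in A i y, φ j x ∂μ) / μ.real (A i y)) ^ 2 ≤ κ := fun j => by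
      -- The terms are those of the protocol in which sensor `i` has the law `φ j ² • μ`.
      set ν : Measure Ω := μ.withDensity fun x => ENNReal.ofReal (φ j x ^ 2) with hν
      have hlin : ∀ s, MeasurableSet s → ν.real s = ∫ x in s, φ j x ^ 2 ∂μ := fun s hs => by
        rw [integral_eq_lintegral_of_nonneg_ae (ae_of_all _ fun x => sq_nonneg _)
          ((hφ j).restrict s).integrable_sq.aestronglyMeasurable, measureReal_def, hν,
          withDensity_apply _ hs]
      have hfin : IsFiniteMeasure ν := isFiniteMeasure_withDensity_ofReal
        (hφ j).integrable_sq.hasFiniteIntegral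
      have hmu : ∀ i', IsFiniteMeasure (if i' = i then ν else μ) := fun i' => by
        split_ifs <;> infer_instance
      have hsum := sum_prod_measureReal_answerSet label bit (fun i' => if i' = i then ν else μ)
        hbit N
      have hsplit : ∀ B : Fin n → Set Ω, ∏ i', (if i' = i then ν else μ).real (B i') =
          ν.real (B i) * ∏ i' ∈ Finset.univ.erase i, μ.real (B i') := fun B => by
        rw [← Finset.mul_prod_erase _ _ (Finset.mem_univ i), if_pos rfl]
        congr 1
        exact Finset.prod_congr rfl fun j hj => by rw [if_neg (Finset.ne_of_mem_erase hj)]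
      rw [hsplit (fun _ => Set.univ), Finset.sum_congr rfl fun y _ => hsplit _,
        hlin _ MeasurableSet.univ] at hsum
      simp only [probReal_univ, Finset.prod_const_one, mul_one, Measure.restrict_univ] at hsum
      refine le_trans ?_ (hnorm j)
      rw [← hsum]
      refine Finset.sum_le_sum fun y _ => ?_
      rw [hprod, hlin _ (hAm i y), mul_comm (μ.real _), mul_assoc, mul_comm _ (R y)]
      refine mul_le_mul_of_nonneg_left ?_ (hR0 y)
      have hcs := sq_setIntegral_le μ (hφ j) (A i y)
      rcases (measureReal_nonneg (μ := μ) (s := A i y)).eq_or_lt with h0 | h0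
      · rw [← h0]; simpa using integral_nonneg fun x => sq_nonneg (φ j x)
      · rw [div_pow, mul_div_assoc', div_le_iff₀ (by positivity)]
        nlinarith
    calc _ ≤ ∑ _j : ι, κ := Finset.sum_le_sum fun j _ => hj j
      _ = κ * Fintype.card ι := by simp [mul_comm]

end Orthogonal

/-! ### Transcripts and risk of a blackboard protocol -/

namespace BlackboardProtocol

variable {Ω : Type v} [MeasurableSpace Ω] {n k : ℕ} (pr : BlackboardProtocol.{v, w} Ω n k)

theorem length_board (r : pr.Rand) (x : Fin n → Ω) (t : ℕ) : (pr.board r x t).length = t := by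
  induction t with
  | zero => rfl
  | succ t ih => simp [board, ih]

theorem board_eq_take_iff (r : pr.Rand) (x : Fin n → Ω) (y : List Bool) :
    ∀ t ≤ y.length, pr.board r x t = y.take t ↔
      ∀ s < t, y[s]? = some (pr.bit r (y.take s) (x (pr.label r (y.take s)))) := by
  intro t
  induction t with
  | zero => simp [board]
  | succ t ih =>
    intro ht
    have hstep : y.take (t + 1) = y.take t ++ [y[t]] := List.take_succ_eq_append_getElem ht
    have hget : y[t]? = some y[t] := List.getElem?_eq_getElem ht
    have ih := ih (by omega)
    rw [board, hstep]
    constructor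
    · intro h
      obtain ⟨h1, h2⟩ := List.append_inj h
        (by rw [length_board, List.length_take]; omega)
      rw [h1] at h2
      intro s hs
      rcases Nat.lt_succ_iff_lt_or_eq.1 hs with hs | rfl
      · exact ih.1 h1 s hs
      · rw [hget]; simpa using h2.symm
    · intro h
      have h1 := ih.2 fun s hs => h s (by omega)
      have h2 := h t (by omega)
      rw [hget] at h2
      rw [h1, Option.some.inj h2]

theorem transcript_eq_iff (r : pr.Rand) (x : Fin n → Ω) {y : List Bool} (hy : y.length = n * k) :
    pr.transcript r x = y ↔ ∀ i, x i ∈ answerSet (pr.label r) (pr.bit r) i y := by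
  have h := pr.board_eq_take_iff r x y (n * k) hy.ge
  rw [List.take_of_length_le hy.le] at h
  rw [transcript, h]
  simp only [answerSet, Set.mem_ofPred_eq, hy]
  exact ⟨fun h i t ht hi => hi ▸ h t ht, fun h t ht => h _ t ht rfl⟩

theorem measurableSet_transcript_eq {y : List Bool} (hy : y.length = n * k) :
    MeasurableSet {q : pr.Rand × (Fin n → Ω) | pr.transcript q.1 q.2 = y} := by
  have h : {q : pr.Rand × (Fin n → Ω) | pr.transcript q.1 q.2 = y} =
      ⋂ i, ⋂ t, ⋂ (_ : t < n * k), {q | pr.label q.1 (y.take t) = i}ᶜ ∪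
        {q | y[t]? = some (pr.bit q.1 (y.take t) (q.2 i))} := by
    ext q
    simp only [Set.mem_ofPred_eq, Set.mem_iInter, Set.mem_union, Set.mem_compl_iff,
      pr.transcript_eq_iff q.1 q.2 hy, answerSet, hy, imp_iff_not_or]
  rw [h]
  refine MeasurableSet.iInter fun i => MeasurableSet.iInter fun t => MeasurableSet.iInter fun _ =>
    MeasurableSet.union (MeasurableSet.compl ?_) ?_
  · exact (pr.measurable_label _).comp measurable_fst (MeasurableSet.singleton i)
  · have hb : Measurable fun q : pr.Rand × (Fin n → Ω) => pr.bit q.1 (y.take t) (q.2 i) :=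
      (pr.measurable_bit (y.take t)).comp
        (measurable_fst.prodMk ((measurable_pi_apply i).comp measurable_snd))
    exact hb (t := {b | y[t]? = some b}) (Set.to_countable _).measurableSet

theorem risk_eq_lintegral_sum {d : ℕ} (P : EuclideanSpace ℝ (Fin d) → Measure Ω)
    {θhat : pr.Rand → List Bool → EuclideanSpace ℝ (Fin d)} (hθ : ∀ y, Measurable fun r => θhat r y)
    (θ : EuclideanSpace ℝ (Fin d)) [IsProbabilityMeasure (P θ)] :
    (Measurable fun r => ∑ y : Fin (n * k) → Bool, ‖θhat r (List.ofFn y) - θ‖ₑ ^ 2 *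
      ∏ i, P θ (answerSet (pr.label r) (pr.bit r) i (List.ofFn y))) ∧
    pr.risk P θhat θ = ∫⁻ r, ∑ y : Fin (n * k) → Bool, ‖θhat r (List.ofFn y) - θ‖ₑ ^ 2 *
      ∏ i, P θ (answerSet (pr.label r) (pr.bit r) i (List.ofFn y)) ∂pr.law := by
  classical
  set T : (Fin (n * k) → Bool) → Set (pr.Rand × (Fin n → Ω)) := fun y =>
    {q | pr.transcript q.1 q.2 = List.ofFn y} with hT
  have hTm : ∀ y, MeasurableSet (T y) := fun y =>
    pr.measurableSet_transcript_eq (List.length_ofFn)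
  have hf : ∀ q : pr.Rand × (Fin n → Ω), ‖θhat q.1 (pr.transcript q.1 q.2) - θ‖ₑ ^ 2 =
      ∑ y, (T y).indicator (fun q => ‖θhat q.1 (List.ofFn y) - θ‖ₑ ^ 2) q := fun q => by
    have hlen : (pr.transcript q.1 q.2).length = n * k := pr.length_board _ _ _
    obtain ⟨y₀, hy₀⟩ : ∃ y₀ : Fin (n * k) → Bool, List.ofFn y₀ = pr.transcript q.1 q.2 := by
      refine ⟨fun i => (pr.transcript q.1 q.2)[i], ?_⟩
      apply List.ext_getElem <;> simp [hlen]
    rw [Finset.sum_eq_single y₀]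
    · rw [Set.indicator_of_mem (show q ∈ T y₀ from hy₀.symm), hy₀]
    · intro y _ hy
      refine Set.indicator_of_notMem (fun hq => hy ?_) _
      exact List.ofFn_injective ((show pr.transcript q.1 q.2 = _ from hq).symm.trans hy₀.symm)
    · simp
  have hm : ∀ y : Fin (n * k) → Bool, Measurable
      ((T y).indicator fun q : pr.Rand × (Fin n → Ω) => ‖θhat q.1 (List.ofFn y) - θ‖ₑ ^ 2) :=
    fun y => Measurable.indicator
      ((((hθ _).comp measurable_fst).sub_const _).enorm.pow_const 2) (hTm y)
  have hin : ∀ r, ∫⁻ x, ∑ y, (T y).indicator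
      (fun q : pr.Rand × (Fin n → Ω) => ‖θhat q.1 (List.ofFn y) - θ‖ₑ ^ 2) (r, x)
        ∂(Measure.pi fun _ : Fin n => P θ) =
      ∑ y : Fin (n * k) → Bool, ‖θhat r (List.ofFn y) - θ‖ₑ ^ 2 *
        ∏ i, P θ (answerSet (pr.label r) (pr.bit r) i (List.ofFn y)) := fun r => by
    have hmr : ∀ y, Measurable fun x : Fin n → Ω => (T y).indicator
        (fun q : pr.Rand × (Fin n → Ω) => ‖θhat q.1 (List.ofFn y) - θ‖ₑ ^ 2) (r, x) :=
      fun y => (hm y).comp measurable_prodMk_left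
    rw [lintegral_finsetSum _ fun y _ => hmr y]
    refine Finset.sum_congr rfl fun y _ => ?_
    have h1 : ∀ x : Fin n → Ω, (T y).indicator
        (fun q : pr.Rand × (Fin n → Ω) => ‖θhat q.1 (List.ofFn y) - θ‖ₑ ^ 2) (r, x) =
        (Set.univ.pi fun i => answerSet (pr.label r) (pr.bit r) i (List.ofFn y)).indicator
          (fun _ => ‖θhat r (List.ofFn y) - θ‖ₑ ^ 2) x := fun x => by
      have : (r, x) ∈ T y ↔
          x ∈ Set.univ.pi fun i => answerSet (pr.label r) (pr.bit r) i (List.ofFn y) := by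
        rw [Set.mem_univ_pi]
        exact pr.transcript_eq_iff r x List.length_ofFn
      by_cases h : (r, x) ∈ T y
      · rw [Set.indicator_of_mem h, Set.indicator_of_mem (this.1 h)]
      · rw [Set.indicator_of_notMem h, Set.indicator_of_notMem (mt this.2 h)]
    simp_rw [h1]
    rw [lintegral_indicator_const, Measure.pi_pi]
    exact MeasurableSet.univ_pi fun i => measurableSet_answerSet _ _
      (fun v => (pr.measurable_bit v).comp measurable_prodMk_left) _ _
  have hmeas : Measurable fun q => ∑ y, (T y).indicator
      (fun q : pr.Rand × (Fin n → Ω) => ‖θhat q.1 (List.ofFn y) - θ‖ₑ ^ 2) q :=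
    Finset.measurable_fun_sum _ fun y _ => hm y
  refine ⟨?_, ?_⟩
  · simp_rw [← hin]
    exact hmeas.lintegral_prod_right'
  · rw [risk]
    simp_rw [hf]
    rw [lintegral_prod _ hmeas.aemeasurable]
    exact lintegral_congr hin

end BlackboardProtocol

/-! ### Assouad's method over a hypercube of two values per coordinate -/

theorem sum_eq_sum_filter_add_update {d : ℕ} (j : Fin d) (g : (Fin d → Bool) → ℝ) :
    ∑ u, g u = ∑ u ∈ Finset.univ.filter (fun u : Fin d → Bool => u j = false),
      (g u + g (Function.update u j true)) := by
  rw [Finset.sum_add_distrib, ← Finset.sum_filter_add_sum_filter_not Finset.univ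
    (fun u : Fin d → Bool => u j = false)]
  congr 1
  refine Finset.sum_nbij' (fun u => Function.update u j false) (fun u => Function.update u j true)
    ?_ ?_ ?_ ?_ ?_
  · simp
  · simp
  · intro u hu
    have : u j = true := by simpa using hu
    simp [← this]
  · intro u hu
    have : u j = false := by simpa using hu
    simp [← this]
  · intro u hu
    have : u j = true := by simpa using hu
    simp [← this]

theorem half_sq_mul_min_le {a b t p q : ℝ} (hp : 0 ≤ p) (hq : 0 ≤ q) :
    (a - b) ^ 2 / 2 * min p q ≤ (t - a) ^ 2 * p + (t - b) ^ 2 * q := by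
  have h1 : (t - a) ^ 2 * min p q ≤ (t - a) ^ 2 * p :=
    mul_le_mul_of_nonneg_left (min_le_left _ _) (sq_nonneg _)
  have h2 : (t - b) ^ 2 * min p q ≤ (t - b) ^ 2 * q :=
    mul_le_mul_of_nonneg_left (min_le_right _ _) (sq_nonneg _)
  have h3 : (a - b) ^ 2 / 2 ≤ (t - a) ^ 2 + (t - b) ^ 2 := by
    nlinarith [sq_nonneg (t - a + (t - b))]
  have := mul_le_mul_of_nonneg_right h3 (le_min hp hq)
  linarith

/-- **Assouad's lemma** for the prior that is uniform on `{t₀, t₀ + δ}^d`, when the affinities of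
neighbouring hypotheses are bounded below on average: moving the coordinate `j` of `u` from `t₀`
to `t₀ + δ` costs `V u j`. -/
theorem assouad_sum_ge {d : ℕ} {Y : Type*} [Fintype Y] (Q : (Fin d → Bool) → Y → ℝ)
    (hQ : ∀ u y, 0 ≤ Q u y) (V : (Fin d → Bool) → Fin d → ℝ)
    (hV : ∀ u j, u j = false →
      1 / 4 - 2 * V u j ≤ ∑ y, min (Q u y) (Q (Function.update u j true) y))
    (hVsum : ∀ u, ∑ j ∈ Finset.univ.filter (fun j => u j = false), V u j ≤ d / 32)
    (est : Y → Fin d → ℝ) (t₀ δ : ℝ) :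
    2 ^ d * (δ ^ 2 * d / 32) ≤
      ∑ u, ∑ y, (∑ j, (est y j - if u j then t₀ + δ else t₀) ^ 2) * Q u y := by
  have hcount : ∀ j : Fin d,
      ∑ u ∈ Finset.univ.filter (fun u : Fin d → Bool => u j = false), (1 : ℝ) = 2 ^ d / 2 :=
    fun j => by
    have := sum_eq_sum_filter_add_update j fun _ => 1
    rw [Finset.sum_add_distrib] at this
    simp only [Finset.sum_const, Finset.card_univ, Fintype.card_pi, Fintype.card_bool,
      Finset.prod_const, Fintype.card_fin, nsmul_eq_mul, mul_one, Nat.cast_pow,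
      Nat.cast_ofNat] at this ⊢
    linarith
  have hswap : ∑ j, ∑ u ∈ Finset.univ.filter (fun u : Fin d → Bool => u j = false), V u j =
      ∑ u, ∑ j ∈ Finset.univ.filter (fun j => u j = false), V u j := by
    simp_rw [Finset.sum_filter]; exact Finset.sum_comm
  have hVtot : ∑ u, ∑ j ∈ Finset.univ.filter (fun j => u j = false), V u j ≤
      2 ^ d * (d / 32) := by
    refine (Finset.sum_le_sum fun u _ => hVsum u).trans_eq ?_
    simp
  calc 2 ^ d * (δ ^ 2 * d / 32)
      ≤ δ ^ 2 / 2 * (d * (2 ^ d / 2) / 4 -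
          2 * ∑ u, ∑ j ∈ Finset.univ.filter (fun j => u j = false), V u j) := by
        nlinarith [mul_le_mul_of_nonneg_left hVtot (sq_nonneg δ)]
    _ = ∑ j : Fin d, ∑ u ∈ Finset.univ.filter (fun u : Fin d → Bool => u j = false),
          δ ^ 2 / 2 * (1 / 4 - 2 * V u j) := by
        rw [← hswap]
        simp_rw [← Finset.mul_sum, Finset.sum_sub_distrib, ← Finset.mul_sum]
        congr 2
        have : ∀ j : Fin d, ∑ u ∈ Finset.univ.filter (fun u : Fin d → Bool => u j = false),
            (1 / 4 : ℝ) = 2 ^ d / 2 / 4 := fun j => by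
          rw [← hcount j, Finset.sum_div]
        simp_rw [this]
        simp
        ring
    _ ≤ ∑ j : Fin d, ∑ u ∈ Finset.univ.filter (fun u : Fin d → Bool => u j = false),
          ((∑ y, (est y j - if u j then t₀ + δ else t₀) ^ 2 * Q u y) +
          ∑ y, (est y j - if Function.update u j true j then t₀ + δ else t₀) ^ 2 *
            Q (Function.update u j true) y) := by
        refine Finset.sum_le_sum fun j _ => Finset.sum_le_sum fun u hu => ?_
        have hu : u j = false := by simpa using hu
        refine (mul_le_mul_of_nonneg_left (hV u j hu) (by positivity)).trans ?_
        rw [Finset.mul_sum, ← Finset.sum_add_distrib]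
        refine Finset.sum_le_sum fun y _ => ?_
        simp only [hu, Function.update_self, if_true, Bool.false_eq_true, if_false]
        have := half_sq_mul_min_le (a := t₀) (b := t₀ + δ) (t := est y j) (hQ u y)
          (hQ (Function.update u j true) y)
        rwa [sub_add_cancel_left, neg_sq] at this
    _ = ∑ u, ∑ y, (∑ j, (est y j - if u j then t₀ + δ else t₀) ^ 2) * Q u y := by
        simp_rw [← sum_eq_sum_filter_add_update _ fun u =>
          ∑ y, (est y _ - if u _ then t₀ + δ else t₀) ^ 2 * Q u y]
        rw [Finset.sum_comm]
        refine Finset.sum_congr rfl fun u _ => ?_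
        rw [Finset.sum_comm]
        exact Finset.sum_congr rfl fun y _ => (Finset.sum_mul _ _ _).symm

/-! ### Neighbouring laws of the hypercube -/

section HypercubeLaw

variable {X : Type*} [MeasurableSpace X] {d : ℕ} (p₀ p₁ : Measure X)

/-- The product law on `Fin d → X` whose factors are `p₁` where `u` is true and `p₀` elsewhere. -/
noncomputable def hypercubeLaw (u : Fin d → Bool) : Measure (Fin d → X) :=
  Measure.pi fun i => if u i then p₁ else p₀

/-- The centred likelihood ratio `dp₁/dp₀ - 1`. -/
noncomputable def centredRatio (x : X) : ℝ := (p₁.rnDeriv p₀ x).toReal - 1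

theorem measurable_centredRatio : Measurable (centredRatio p₀ p₁) :=
  (Measure.measurable_rnDeriv _ _).ennreal_toReal.sub_const 1

variable [IsProbabilityMeasure p₀] [IsProbabilityMeasure p₁]

instance isProbabilityMeasure_ite (b : Bool) : IsProbabilityMeasure (if b then p₁ else p₀) := by
  split_ifs <;> infer_instance

instance (u : Fin d → Bool) : IsProbabilityMeasure (hypercubeLaw p₀ p₁ u) := by
  unfold hypercubeLaw; infer_instance

variable {p₀ p₁}

theorem integral_centredRatio (hac : p₁ ≪ p₀) : ∫ x, centredRatio p₀ p₁ x ∂p₀ = 0 := by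
  unfold centredRatio
  rw [integral_sub Measure.integrable_toReal_rnDeriv (integrable_const 1),
    Measure.integral_toReal_rnDeriv hac]
  simp

theorem measurePreserving_eval_hypercubeLaw {u : Fin d → Bool} {j : Fin d} (hj : u j = false) :
    MeasurePreserving (Function.eval j) (hypercubeLaw p₀ p₁ u) p₀ := by
  simpa [hypercubeLaw, hj] using measurePreserving_eval (fun i => if u i then p₁ else p₀) j

theorem hypercubeLaw_update (hac : p₁ ≪ p₀) {u : Fin d → Bool} {j : Fin d} (hj : u j = false) :
    hypercubeLaw p₀ p₁ (Function.update u j true) =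
      (hypercubeLaw p₀ p₁ u).withDensity fun x => p₁.rnDeriv p₀ (x j) := by
  refine pi_eq_withDensity_eval (fun i => if u i then p₁ else p₀)
    (fun i => if Function.update u j true i then p₁ else p₀) j (Measure.measurable_rnDeriv _ _)
    ?_ fun i hi => ?_
  · simp [hj, Measure.withDensity_rnDeriv_eq _ _ hac]
  · simp [Function.update_of_ne hi]

theorem measureReal_hypercubeLaw_update (hac : p₁ ≪ p₀) {u : Fin d → Bool} {j : Fin d}
    (hj : u j = false) {A : Set (Fin d → X)} (hA : MeasurableSet A) :
    (hypercubeLaw p₀ p₁ (Function.update u j true)).real A = (hypercubeLaw p₀ p₁ u).real A +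
      ∫ x in A, centredRatio p₀ p₁ (x j) ∂hypercubeLaw p₀ p₁ u := by
  have hmp := measurePreserving_eval_hypercubeLaw (p₀ := p₀) (p₁ := p₁) hj
  have hint : Integrable (fun x : Fin d → X => (p₁.rnDeriv p₀ (x j)).toReal)
      (hypercubeLaw p₀ p₁ u) :=
    hmp.integrable_comp_of_integrable Measure.integrable_toReal_rnDeriv
  have hae : ∀ᵐ x ∂hypercubeLaw p₀ p₁ u, p₁.rnDeriv p₀ (x j) < ∞ :=
    hmp.quasiMeasurePreserving.ae (Measure.rnDeriv_lt_top p₁ p₀)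
  unfold centredRatio
  rw [integral_sub hint.integrableOn (integrable_const 1)]
  simp only [integral_const, measureReal_restrict_apply_univ, smul_eq_mul, mul_one,
    add_sub_cancel]
  rw [hypercubeLaw_update hac hj, measureReal_def, withDensity_apply _ hA]
  have hm : Measurable fun x : Fin d → X => p₁.rnDeriv p₀ (x j) :=
    (Measure.measurable_rnDeriv _ _).comp (measurable_pi_apply j)
  rw [integral_toReal hm.aemeasurable (ae_restrict_of_ae hae)]

/-- Minimax bound for one deterministic protocol and one estimator: if the total information
`n κ min(2 ^ k, d)` is at most `d / 32`, the squared errors at the `2 ^ d` laws of the hypercube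
average to at least `δ² d / 32`. -/
theorem sum_sq_error_hypercubeLaw_ge (hac : p₁ ≪ p₀) {κ : ℝ} (hκ : 0 < κ)
    (hL2 : MemLp (centredRatio p₀ p₁) 2 p₀) (hnorm : ∫ x, centredRatio p₀ p₁ x ^ 2 ∂p₀ ≤ κ)
    {n N k : ℕ} (hinfo : n * (κ * min ((2 : ℝ) ^ k) d) ≤ d / 32)
    (label : List Bool → Fin n) (bit : List Bool → (Fin d → X) → Bool)
    (hbit : ∀ y, Measurable (bit y))
    (hk : ∀ y : List Bool, y.length = N → ∀ i,
      ((Finset.range N).filter fun t => label (y.take t) = i).card = k)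
    (est : (Fin N → Bool) → Fin d → ℝ) (t₀ δ : ℝ) :
    2 ^ d * (δ ^ 2 * d / 32) ≤
      ∑ u : Fin d → Bool, ∑ y : Fin N → Bool, (∑ j, (est y j - if u j then t₀ + δ else t₀) ^ 2) *
        ∏ i, (hypercubeLaw p₀ p₁ u).real (answerSet label bit i (List.ofFn y)) := by
  classical
  set a : (Fin d → Bool) → Fin n → (Fin N → Bool) → ℝ := fun u i y =>
    (hypercubeLaw p₀ p₁ u).real (answerSet label bit i (List.ofFn y)) with ha
  have hAm : ∀ i (y : Fin N → Bool), MeasurableSet (answerSet label bit i (List.ofFn y)) :=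
    fun i y => measurableSet_answerSet label bit hbit i _
  refine assouad_sum_ge (fun u y => ∏ i, a u i y)
    (fun u y => Finset.prod_nonneg fun i _ => measureReal_nonneg)
    (fun u j => ∑ i, ∑ y, (∏ i', a u i' y) *
      (a (Function.update u j true) i y / a u i y - 1) ^ 2) ?_ ?_ est t₀ δ
  · intro u j hj
    refine quarter_sub_le_sum_min_prod _ _ (fun _ _ => measureReal_nonneg)
      (fun _ _ => measureReal_nonneg) ?_ ?_
    · intro i y h0
      have hac' : hypercubeLaw p₀ p₁ (Function.update u j true) ≪ hypercubeLaw p₀ p₁ u := by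
        rw [hypercubeLaw_update hac hj]; exact withDensity_absolutelyContinuous _ _
      exact (measureReal_eq_zero_iff).2 (hac' ((measureReal_eq_zero_iff).1 h0))
    · intro c _
      have := sum_prod_measureReal_answerSet label bit
        (fun i => hypercubeLaw p₀ p₁ (if c i then Function.update u j true else u)) hbit N
      simp only [probReal_univ, Finset.prod_const_one] at this
      rw [← this]
      refine Finset.sum_congr rfl fun y _ => Finset.prod_congr rfl fun i _ => ?_
      simp only [ha]
      split_ifs <;> rfl
  · intro u
    have hmp : ∀ j : {j // u j = false},
        MeasurePreserving (Function.eval j.1) (hypercubeLaw p₀ p₁ u) p₀ :=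
      fun j => measurePreserving_eval_hypercubeLaw j.2
    rw [Finset.sum_subtype (p := fun j => u j = false) _ (by simp), Finset.sum_comm]
    have hi : ∀ i, ∑ j : {j // u j = false}, ∑ y, (∏ i', a u i' y) *
        (a (Function.update u j.1 true) i y / a u i y - 1) ^ 2 ≤ κ * min ((2 : ℝ) ^ k) d := by
      intro i
      have h := sum_sum_prod_mul_sq_le (hypercubeLaw p₀ p₁ u)
        (φ := fun (j : {j // u j = false}) x => centredRatio p₀ p₁ (x j.1)) hκ
        (fun j => hL2.comp_measurePreserving (hmp j))
        (fun j j' hjj' => by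
          have hs := fun j : {j // u j = false} => show AEStronglyMeasurable (centredRatio p₀ p₁)
            (if u j.1 then p₁ else p₀) from (measurable_centredRatio p₀ p₁).aestronglyMeasurable
          have := integral_pi_mul_eval (fun i => if u i then p₁ else p₀)
            (fun h => hjj' (Subtype.ext h)) (hs j) (hs j')
          rw [hypercubeLaw, this, j.2]
          simp [integral_centredRatio hac])
        (fun j => by
          refine le_trans (le_of_eq ?_) hnorm
          have := integral_map (μ := hypercubeLaw p₀ p₁ u) (hmp j).measurable.aemeasurable
            ((measurable_centredRatio p₀ p₁).pow_const 2).aestronglyMeasurable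
          rw [(hmp j).map_eq] at this
          exact this.symm)
        label bit hbit i (fun y hy => hk y hy i)
      refine le_trans (le_of_eq ?_) (h.trans ?_)
      · refine Finset.sum_congr rfl fun j _ => Finset.sum_congr rfl fun y _ => ?_
        by_cases h0 : a u i y = 0
        · have hz : ∏ i', a u i' y = 0 := Finset.prod_eq_zero (Finset.mem_univ i) h0
          change (∏ i', a u i' y) * _ = (∏ i', a u i' y) * _
          rw [hz, zero_mul, zero_mul]
        · have : a (Function.update u j.1 true) i y / a u i y - 1 =
              (∫ x in answerSet label bit i (List.ofFn y), centredRatio p₀ p₁ (x j.1)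
                ∂hypercubeLaw p₀ p₁ u) / a u i y := by
            rw [div_sub_one h0]
            congr 1
            exact sub_eq_of_eq_add' (measureReal_hypercubeLaw_update hac j.2 (hAm i y))
          rw [this]
      · refine mul_le_mul_of_nonneg_left (min_le_min le_rfl ?_) hκ.le
        exact_mod_cast (Fintype.card_subtype_le _).trans_eq (Fintype.card_fin d)
    calc _ ≤ ∑ _i : Fin n, κ * min ((2 : ℝ) ^ k) d := Finset.sum_le_sum fun i _ => hi i
      _ ≤ d / 32 := by simpa using hinfo

end HypercubeLaw

/-! ### Scores of models differentiable in quadratic mean -/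

theorem memLp_two_of_lintegral_sq_le {Ω : Type*} [MeasurableSpace Ω] {μ : Measure Ω} {f : Ω → ℝ}
    (hf : AEStronglyMeasurable f μ) {c : ℝ} (hc : 0 ≤ c)
    (h : ∫⁻ x, ENNReal.ofReal (f x ^ 2) ∂μ ≤ ENNReal.ofReal c) :
    MemLp f 2 μ ∧ ∫ x, f x ^ 2 ∂μ ≤ c := by
  have hint : Integrable (fun x => f x ^ 2) μ :=
    (lintegral_ofReal_ne_top_iff_integrable (hf.pow 2) (ae_of_all _ fun x => sq_nonneg _)).1
      (ne_top_of_le_ne_top ENNReal.ofReal_ne_top h)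
  refine ⟨(memLp_two_iff_integrable_sq hf).2 hint, ?_⟩
  rwa [← ENNReal.ofReal_le_ofReal_iff hc, ofReal_integral_eq_lintegral_ofReal hint
    (ae_of_all _ fun x => sq_nonneg _)]

section Score

variable {E : Type*} [NormedAddCommGroup E] [InnerProductSpace ℝ E] {Ω : Type*}
  [MeasurableSpace Ω]

/-- The remainder of the first-order expansion of the square root of the density at `θ₀`. -/
noncomputable def sqrtRemainder (P : E → Measure Ω) (θ₀ : E) (S : Ω → E) (θ : E) (x : Ω) : ℝ :=
  √(((P θ).rnDeriv (P θ₀) x).toReal) - 1 - (1 / 2) * inner ℝ (θ - θ₀) (S x)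

theorem DiffInQuadraticMean.eventually_sqrtRemainder {P : E → Measure Ω} {Θ : Set E} {θ₀ : E}
    {S : Ω → E} (h : DiffInQuadraticMean P Θ θ₀ S) {ε : ℝ} (hε : 0 < ε) :
    ∀ᶠ θ in 𝓝[Θ] θ₀, MemLp (sqrtRemainder P θ₀ S θ) 2 (P θ₀) ∧
      ∫ x, sqrtRemainder P θ₀ S θ x ^ 2 ∂P θ₀ ≤ ε * ‖θ - θ₀‖ ^ 2 := by
  filter_upwards [h.2 ε hε] with θ hθ
  refine memLp_two_of_lintegral_sq_le ?_ (by positivity) (le_self_add.trans hθ)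
  unfold sqrtRemainder
  exact (((Measure.measurable_rnDeriv _ _).ennreal_toReal.sqrt.sub_const
    1).aestronglyMeasurable).sub
    ((aestronglyMeasurable_const.inner h.1.aestronglyMeasurable).const_mul _)

end Score

/-- The score is centred. With `f` the density of `p (t₀ + h)` and `R` the remainder of `√f`, one
has `f - 1 ≥ h s₀ + 2 R` pointwise while `∫ f ≤ 1`, so `h ∫ s₀ ≤ o(h)` for both signs of `h`. -/
theorem DiffInQuadraticMean.integral_score_eq_zero {X : Type*} [MeasurableSpace X]
    {p : ℝ → Measure X} [∀ t, IsProbabilityMeasure (p t)] {t₀ : ℝ} {s₀ : X → ℝ}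
    (h : DiffInQuadraticMean p Set.univ t₀ s₀) : ∫ x, s₀ x ∂p t₀ = 0 := by
  have hs : Integrable s₀ (p t₀) := h.1.integrable (by norm_num)
  have key : ∀ η : ℝ, 0 < η → |∫ x, s₀ x ∂p t₀| ≤ 2 * η := fun η hη => by
    have hev := h.eventually_sqrtRemainder (ε := η ^ 2) (by positivity)
    rw [nhdsWithin_univ] at hev
    obtain ⟨r, hr, hball⟩ := Metric.eventually_nhds_iff.1 hev
    have hstep : ∀ a : ℝ, |a| < r → a * ∫ x, s₀ x ∂p t₀ ≤ 2 * η * |a| := fun a ha => by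
      obtain ⟨hR, hR2⟩ := hball (y := t₀ + a) (by simpa [Real.dist_eq] using ha)
      set R := sqrtRemainder p t₀ s₀ (t₀ + a) with hRdef
      have hRint : Integrable R (p t₀) := hR.integrable (by norm_num)
      have hpt : ∀ x, a * s₀ x + 2 * R x ≤ ((p (t₀ + a)).rnDeriv (p t₀) x).toReal - 1 :=
        fun x => by
        have h1 : √(((p (t₀ + a)).rnDeriv (p t₀) x).toReal) = 1 + a * s₀ x / 2 + R x := by
          simp only [hRdef, sqrtRemainder, add_sub_cancel_left]
          simp
          ring
        have h2 := Real.sq_sqrt (ENNReal.toReal_nonneg (a := (p (t₀ + a)).rnDeriv (p t₀) x))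
        rw [h1] at h2
        nlinarith [sq_nonneg (a * s₀ x / 2 + R x)]
      have hle : ∫ x, (a * s₀ x + 2 * R x) ∂p t₀ ≤
          ∫ x, (((p (t₀ + a)).rnDeriv (p t₀) x).toReal - 1) ∂p t₀ :=
        integral_mono ((hs.const_mul a).add (hRint.const_mul 2))
          (Measure.integrable_toReal_rnDeriv.sub (integrable_const 1)) hpt
      rw [integral_sub Measure.integrable_toReal_rnDeriv (integrable_const 1)] at hle
      have hsum : ∫ x, (a * s₀ x + 2 * R x) ∂p t₀ = a * ∫ x, s₀ x ∂p t₀ + 2 * ∫ x, R x ∂p t₀ := by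
        rw [integral_add (hs.const_mul a) (hRint.const_mul 2), integral_const_mul,
          integral_const_mul]
      have hmass : ∫ x, ((p (t₀ + a)).rnDeriv (p t₀) x).toReal ∂p t₀ ≤ 1 := by
        have := Measure.setIntegral_toReal_rnDeriv_le (μ := p (t₀ + a)) (ν := p t₀)
          (s := Set.univ) (measure_ne_top _ _)
        simpa using this
      have hRabs : |∫ x, R x ∂p t₀| ≤ η * |a| := by
        have hcs := sq_setIntegral_le (p t₀) hR Set.univ
        simp only [Measure.restrict_univ, probReal_univ, one_mul] at hcs
        refine abs_le_of_sq_le_sq (hcs.trans (hR2.trans_eq ?_)) (by positivity)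
        rw [add_sub_cancel_left, Real.norm_eq_abs, mul_pow]
      have hle' : a * ∫ x, s₀ x ∂p t₀ + 2 * ∫ x, R x ∂p t₀ ≤ 0 := by
        rw [← hsum]
        refine hle.trans ?_
        simpa using hmass
      linarith [(abs_le.1 hRabs).1]
    have h1 := hstep (r / 2) (by rw [abs_of_pos (by positivity)]; linarith)
    have h2 := hstep (-(r / 2)) (by rw [abs_neg, abs_of_pos (by positivity)]; linarith)
    rw [abs_neg] at h2
    rw [abs_of_pos (by positivity)] at h1 h2
    have hr2 : 0 < r / 2 := by positivity
    exact abs_le.2 ⟨by nlinarith, by nlinarith⟩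
  rw [← abs_nonpos_iff]
  refine le_of_forall_pos_le_add fun η hη => ?_
  linarith [key (η / 2) (by positivity)]

instance {X : Type*} [MeasurableSpace X] (p : ℝ → Measure X) [∀ t, IsProbabilityMeasure (p t)]
    (d : ℕ) (θ : EuclideanSpace ℝ (Fin d)) : IsProbabilityMeasure (productModel p d θ) := by
  unfold productModel; infer_instance

section ProductScore

variable {X : Type v} [MeasurableSpace X] {p : ℝ → Measure X} [∀ t, IsProbabilityMeasure (p t)]
  {d : ℕ} {t₀ : ℝ}

theorem measurePreserving_eval_productModel (θ : EuclideanSpace ℝ (Fin d)) (i : Fin d) :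
    MeasurePreserving (Function.eval i) (productModel p d θ) (p (θ i)) :=
  measurePreserving_eval (fun i => p (θ i)) i

/-- The coordinates of the score of a product model are the one-dimensional scores: along the
coordinate direction `i` the likelihood ratio of the product model is that of the `i`-th factor, and
the derivative in quadratic mean is unique. -/
theorem DiffInQuadraticMean.score_ae_eq {s₀ : X → ℝ} {S : (Fin d → X) → EuclideanSpace ℝ (Fin d)}
    {Θ : Set (EuclideanSpace ℝ (Fin d))} (h₀ : DiffInQuadraticMean p Set.univ t₀ s₀)
    (h : DiffInQuadraticMean (productModel p d) Θ (constVec d t₀) S) {r : ℝ} (hr : 0 < r)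
    (hcube : cube (constVec d t₀) r ⊆ Θ) (hac : ∀ a, 0 < a → a < r → p (t₀ + a) ≪ p t₀)
    (i : Fin d) :
    (fun x => S x i) =ᵐ[productModel p d (constVec d t₀)] fun x => s₀ (x i) := by
  classical
  set P₀ := productModel p d (constVec d t₀) with hP₀
  have hmp : MeasurePreserving (Function.eval i) P₀ (p t₀) :=
    measurePreserving_eval_productModel (constVec d t₀) i
  have hSi : MemLp (fun x => S x i) 2 P₀ := by
    have := (EuclideanSpace.proj (𝕜 := ℝ) i : EuclideanSpace ℝ (Fin d) →L[ℝ] ℝ).comp_memLp' h.1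
    exact this
  have hsi : MemLp (fun x : Fin d → X => s₀ (x i)) 2 P₀ := h₀.1.comp_measurePreserving hmp
  have hD : MemLp (fun x => S x i - s₀ (x i)) 2 P₀ := hSi.sub hsi
  have key : ∀ ε : ℝ, 0 < ε → ∫ x, (S x i - s₀ (x i)) ^ 2 ∂P₀ ≤ 16 * ε := fun ε hε => by
    have hev := h.eventually_sqrtRemainder hε
    have hev₀ := h₀.eventually_sqrtRemainder hε
    rw [nhdsWithin_univ] at hev₀
    obtain ⟨r₀, hr₀, hball₀⟩ := Metric.eventually_nhds_iff.1 hev₀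
    obtain ⟨r₁, hr₁, hball₁⟩ := Metric.eventually_nhds_iff.1 (eventually_nhdsWithin_iff.1 hev)
    obtain ⟨a, ha, har⟩ : ∃ a, 0 < a ∧ a < min r (min r₀ r₁) :=
      exists_between (lt_min hr (lt_min hr₀ hr₁))
    have har₁ : a < r := har.trans_le (min_le_left _ _)
    have har₂ : a < r₀ := har.trans_le ((min_le_right _ _).trans (min_le_left _ _))
    have har₃ : a < r₁ := har.trans_le ((min_le_right _ _).trans (min_le_right _ _))
    set θ := constVec d t₀ + EuclideanSpace.single i a with hθ
    have hθΘ : θ ∈ Θ := hcube fun j => by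
      simp only [hθ, PiLp.add_apply, add_sub_cancel_left, PiLp.single_apply]
      split_ifs
      · rw [abs_of_pos ha]; exact har₁.le
      · simpa using hr.le
    have hnorm : ‖θ - constVec d t₀‖ = a := by
      rw [hθ, add_sub_cancel_left, PiLp.norm_single, Real.norm_of_nonneg ha.le]
    obtain ⟨hA, hA2⟩ := hball₁ (y := θ) (by rw [dist_eq_norm, hnorm]; exact har₃) hθΘ
    obtain ⟨hB, hB2⟩ := hball₀ (y := t₀ + a)
      (by rw [Real.dist_eq, add_sub_cancel_left, abs_of_pos ha]; exact har₂)
    have hB' := hB.comp_measurePreserving hmp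
    have hB2' : ∫ x, sqrtRemainder p t₀ s₀ (t₀ + a) (x i) ^ 2 ∂P₀ ≤ ε * a ^ 2 := by
      have := integral_map (μ := P₀) hmp.measurable.aemeasurable
        (f := fun x => sqrtRemainder p t₀ s₀ (t₀ + a) x ^ 2)
        (by rw [hmp.map_eq]; exact hB.integrable_sq.aestronglyMeasurable)
      rw [hmp.map_eq] at this
      refine this.symm.le.trans (hB2.trans_eq ?_)
      rw [add_sub_cancel_left, Real.norm_of_nonneg ha.le]
    rw [hnorm] at hA2
    have hdens : productModel p d θ = P₀.withDensity fun x => (p (t₀ + a)).rnDeriv (p t₀) (x i) :=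
      pi_eq_withDensity_eval (fun j => p (constVec d t₀ j)) (fun j => p (θ j)) i
        (Measure.measurable_rnDeriv _ _)
        (by
          rw [show constVec d t₀ i = t₀ from rfl,
            Measure.withDensity_rnDeriv_eq _ _ (hac a ha har₁)]
          simp [hθ, constVec])
        (fun j hj => by simp [hθ, hj])
    have hrn : (productModel p d θ).rnDeriv P₀ =ᵐ[P₀]
        fun x => (p (t₀ + a)).rnDeriv (p t₀) (x i) := by
      rw [hdens]
      exact Measure.rnDeriv_withDensity _
        ((Measure.measurable_rnDeriv _ _).comp (measurable_pi_apply i))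
    have hdiff : ∀ᵐ x ∂P₀, (S x i - s₀ (x i)) ^ 2 ≤ 8 / a ^ 2 *
        (sqrtRemainder (productModel p d) (constVec d t₀) S θ x ^ 2 +
          sqrtRemainder p t₀ s₀ (t₀ + a) (x i) ^ 2) := by
      filter_upwards [hrn] with x hx
      have h1 : a / 2 * (S x i - s₀ (x i)) = sqrtRemainder p t₀ s₀ (t₀ + a) (x i) -
          sqrtRemainder (productModel p d) (constVec d t₀) S θ x := by
        have hin : inner ℝ (θ - constVec d t₀) (S x) = a * S x i := by
          rw [hθ, add_sub_cancel_left, EuclideanSpace.inner_single_left]; simp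
        have hin₀ : inner ℝ (t₀ + a - t₀) (s₀ (x i)) = a * s₀ (x i) := by
          rw [add_sub_cancel_left]; simp [mul_comm]
        simp only [sqrtRemainder]
        rw [hin, hin₀, hx]
        ring
      have h2 : (S x i - s₀ (x i)) ^ 2 = 4 / a ^ 2 * (a / 2 * (S x i - s₀ (x i))) ^ 2 := by
        field_simp; norm_num
      rw [h2, h1, show (8 : ℝ) / a ^ 2 = 4 / a ^ 2 * 2 by ring, mul_assoc]
      refine mul_le_mul_of_nonneg_left ?_ (by positivity)
      nlinarith [sq_nonneg (sqrtRemainder p t₀ s₀ (t₀ + a) (x i) +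
        sqrtRemainder (productModel p d) (constVec d t₀) S θ x)]
    have hle := integral_mono_ae hD.integrable_sq
      ((hA.integrable_sq.add hB'.integrable_sq).const_mul (8 / a ^ 2)) hdiff
    refine hle.trans ?_
    rw [integral_const_mul]
    have hadd := integral_add hA.integrable_sq hB'.integrable_sq
    simp only [Pi.add_apply, Function.comp_apply, Function.eval] at hadd ⊢
    rw [hadd]
    calc _ ≤ 8 / a ^ 2 * (ε * a ^ 2 + ε * a ^ 2) :=
          mul_le_mul_of_nonneg_left (add_le_add hA2 hB2') (by positivity)
      _ = 16 * ε := by field_simp; norm_num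
  have hzero : ∫ x, (S x i - s₀ (x i)) ^ 2 ∂P₀ = 0 := by
    refine le_antisymm (le_of_forall_pos_le_add fun ε hε => ?_)
      (integral_nonneg fun x => sq_nonneg _)
    linarith [key (ε / 16) (by positivity)]
  have hae := (integral_eq_zero_iff_of_nonneg (fun x => sq_nonneg _) hD.integrable_sq).1 hzero
  filter_upwards [hae] with x hx
  exact sub_eq_zero.1 (pow_eq_zero_iff (two_ne_zero) |>.1 hx)

end ProductScore

/-! ### From the remainder bound to a one-dimensional `χ²` bound -/

theorem integral_mul_le_mul {Ω : Type*} [MeasurableSpace Ω] {μ : Measure Ω} {f g : Ω → ℝ}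
    (hf : MemLp f 2 μ) (hg : MemLp g 2 μ) {a b : ℝ} (ha : 0 ≤ a) (hb : 0 ≤ b)
    (hfa : ∫ x, f x ^ 2 ∂μ ≤ a ^ 2) (hgb : ∫ x, g x ^ 2 ∂μ ≤ b ^ 2) :
    |∫ x, f x * g x ∂μ| ≤ a * b := by
  refine abs_le_of_sq_le_sq ?_ (mul_nonneg ha hb)
  rw [mul_pow]
  exact (sq_integral_mul_le μ hf hg).trans
    (mul_le_mul hfa hgb (integral_nonneg fun x => sq_nonneg _) (sq_nonneg _))

theorem half_le_mean_sign {d : ℕ} (j : Fin d) (F : ℤˣ → ℝ) (hF : ∀ e, 0 ≤ F e) :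
    F 1 / 2 ≤ ((2 : ℝ) ^ d)⁻¹ * ∑ u : Fin d → ℤˣ, F (u j) := by
  have h1 : ∑ u : Fin d → ℤˣ, F (-(u j)) = ∑ u : Fin d → ℤˣ, F (u j) :=
    Equiv.sum_comp (Equiv.neg (Fin d → ℤˣ)) fun u => F (u j)
  have h2 : ∑ _u : Fin d → ℤˣ, F 1 ≤ ∑ u : Fin d → ℤˣ, (F (u j) + F (-(u j))) := by
    refine Finset.sum_le_sum fun u _ => ?_
    rcases Int.units_eq_one_or (u j) with h | h
    · rw [h]; linarith [hF (-1)]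
    · rw [h, neg_neg]; linarith [hF (-1)]
  rw [Finset.sum_add_distrib, h1] at h2
  simp only [Finset.sum_const, Finset.card_univ, Fintype.card_pi, Fintype.card_units_int,
    Finset.prod_const, Fintype.card_fin, nsmul_eq_mul, Nat.cast_pow, Nat.cast_ofNat] at h2
  rw [inv_mul_eq_div, le_div_iff₀ (by positivity)]
  linarith

section ChiSquare

variable {X : Type v} [MeasurableSpace X] {p : ℝ → Measure X} [∀ t, IsProbabilityMeasure (p t)]
  {d : ℕ} {t₀ : ℝ}

theorem constVec_add_smul_signVec_apply (δ : ℝ) (u : Fin d → ℤˣ) (j : Fin d) :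
    (constVec d t₀ + δ • signVec u) j = t₀ + δ * ((u j : ℤ) : ℝ) := by
  simp [constVec, signVec]

theorem absolutelyContinuous_of_productModel {θ θ' : EuclideanSpace ℝ (Fin d)}
    (h : productModel p d θ ≪ productModel p d θ') (j : Fin d) : p (θ j) ≪ p (θ' j) := by
  rw [← (measurePreserving_eval_productModel (p := p) θ j).map_eq,
    ← (measurePreserving_eval_productModel (p := p) θ' j).map_eq]
  exact h.map (measurable_pi_apply j)

theorem integral_rnDeriv_sub_one_mul {Ω : Type*} [MeasurableSpace Ω] {μ ν : Measure Ω}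
    [IsProbabilityMeasure μ] [IsProbabilityMeasure ν] (hac : μ ≪ ν) {G : Ω → ℝ}
    (hG : Measurable G) {M : ℝ} (hM : ∀ x, |G x| ≤ M) :
    Integrable (fun x => ((μ.rnDeriv ν x).toReal - 1) * G x) ν ∧
    ∫ x, ((μ.rnDeriv ν x).toReal - 1) * G x ∂ν = ∫ x, G x ∂μ - ∫ x, G x ∂ν := by
  have hGint : ∀ κ : Measure Ω, [IsProbabilityMeasure κ] → Integrable G κ := fun κ _ =>
    Integrable.of_bound hG.aestronglyMeasurable M (ae_of_all _ fun x => hM x)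
  have h1 : Integrable (fun x => (μ.rnDeriv ν x).toReal * G x) ν :=
    (integrable_toReal_rnDeriv_mul_iff hac).2 (hGint μ)
  simp_rw [sub_mul, one_mul]
  refine ⟨h1.sub (hGint ν), ?_⟩
  rw [integral_sub h1 (hGint ν), integral_toReal_rnDeriv_mul hac]

/-- The remainder is tested against `g(x j) g(x' j)`. The likelihood part of the remainder gives
the average over both signs of the squared change of the mean of `g`, and the score part gives
at most `δ² I₀ ∫ g²`, as the scores of the coordinates other than `j` are independent of `x j`. -/
theorem half_sq_integral_sub_le {s₀ : X → ℝ} {S : (Fin d → X) → EuclideanSpace ℝ (Fin d)}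
    (hs₀ : MemLp s₀ 2 (p t₀)) (hs₀0 : ∫ x, s₀ x ∂p t₀ = 0)
    (hS : MemLp S 2 (productModel p d (constVec d t₀)))
    (hSs : ∀ i, (fun x => S x i) =ᵐ[productModel p d (constVec d t₀)] fun x => s₀ (x i))
    {δ H : ℝ} (hH : 0 ≤ H)
    (hac : ∀ u : Fin d → ℤˣ,
      productModel p d (constVec d t₀ + δ • signVec u) ≪ productModel p d (constVec d t₀))
    (hrem : ∫⁻ z, ENNReal.ofReal
        (likelihoodRemainder (productModel p d) (constVec d t₀) S δ z.1 z.2 ^ 2)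
        ∂((productModel p d (constVec d t₀)).prod (productModel p d (constVec d t₀))) ≤
      ENNReal.ofReal (H ^ 2))
    (j : Fin d) {g : X → ℝ} (hg : Measurable g) {M : ℝ} (hM : ∀ x, |g x| ≤ M) :
    (∫ x, g x ∂p (t₀ + δ) - ∫ x, g x ∂p t₀) ^ 2 / 2 ≤
      (δ ^ 2 * fisherInfo (p t₀) s₀ + H) * ∫ x, g x ^ 2 ∂p t₀ := by
  classical
  set P₀ := productModel p d (constVec d t₀) with hP₀
  have hmp : ∀ i, MeasurePreserving (Function.eval i) P₀ (p t₀) := fun i =>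
    measurePreserving_eval_productModel (constVec d t₀) i
  have hg2 : MemLp g 2 (p t₀) :=
    MemLp.of_bound hg.aestronglyMeasurable M (ae_of_all _ fun x => hM x)
  set G : (Fin d → X) → ℝ := fun x => g (x j) with hGdef
  have hGm : Measurable G := hg.comp (measurable_pi_apply j)
  have hGM : ∀ x, |G x| ≤ M := fun x => hM _
  have hG2 : MemLp G 2 P₀ := hg2.comp_measurePreserving (hmp j)
  have hcomp : ∀ (θ : EuclideanSpace ℝ (Fin d)) (i : Fin d) (f : X → ℝ),
      AEStronglyMeasurable f (p (θ i)) →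
      ∫ x, f (x i) ∂productModel p d θ = ∫ x, f x ∂p (θ i) := fun θ i f hf =>
    integral_comp_eval (μ := fun i => p (θ i)) hf
  have hGsq : ∫ x, G x ^ 2 ∂P₀ = ∫ x, g x ^ 2 ∂p t₀ :=
    hcomp (constVec d t₀) j (fun x => g x ^ 2) (hg.pow_const 2).aestronglyMeasurable
  set N := ∫ x, g x ^ 2 ∂p t₀ with hN
  have hN0 : 0 ≤ N := integral_nonneg fun x => sq_nonneg _
  -- the likelihood ratios and the scores tested against `G`
  set D : (Fin d → ℤˣ) → (Fin d → X) → ℝ := fun u x =>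
    (((productModel p d (constVec d t₀ + δ • signVec u)).rnDeriv P₀ x).toReal - 1) * G x with hD
  have hDint : ∀ u, Integrable (D u) P₀ := fun u =>
    (integral_rnDeriv_sub_one_mul (hac u) hGm hGM).1
  set a : ℤˣ → ℝ := fun e => ∫ x, g x ∂p (t₀ + δ * ((e : ℤ) : ℝ)) - ∫ x, g x ∂p t₀ with ha
  have hDval : ∀ u, ∫ x, D u x ∂P₀ = a (u j) := fun u => by
    rw [(integral_rnDeriv_sub_one_mul (hac u) hGm hGM).2, hGdef,
      hcomp _ j g hg.aestronglyMeasurable, hP₀, hcomp _ j g hg.aestronglyMeasurable,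
      constVec_add_smul_signVec_apply]
    rfl
  have hSi : ∀ i, MemLp (fun x => S x i) 2 P₀ := fun i =>
    (EuclideanSpace.proj (𝕜 := ℝ) i : EuclideanSpace ℝ (Fin d) →L[ℝ] ℝ).comp_memLp' hS
  have hSG : ∀ i, Integrable (fun x => S x i * G x) P₀ := fun i => (hSi i).integrable_mul hG2
  have hSGval : ∀ i, i ≠ j → ∫ x, S x i * G x ∂P₀ = 0 := fun i hij => by
    have h1 : ∫ x, S x i * G x ∂P₀ = ∫ x, s₀ (x i) * g (x j) ∂P₀ :=
      integral_congr_ae (by filter_upwards [hSs i] with x hx; rw [hx])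
    have h2 := integral_pi_mul_eval (fun i => p (constVec d t₀ i)) hij
      (f := s₀) (g := g) hs₀.aestronglyMeasurable hg.aestronglyMeasurable
    have h3 : ∫ x, s₀ x ∂p (constVec d t₀ i) = 0 := hs₀0
    rw [h3, zero_mul] at h2
    exact h1.trans h2
  have hSGsum : ∑ i, (∫ x, S x i * G x ∂P₀) ^ 2 ≤ fisherInfo (p t₀) s₀ * N := by
    rw [Finset.sum_eq_single j (fun i _ hij => by rw [hSGval i hij]; simp) (by simp)]
    refine (sq_integral_mul_le P₀ (hSi j) hG2).trans_eq ?_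
    rw [hGsq]
    congr 1
    rw [fisherInfo, ← show ∫ x, s₀ (x j) ^ 2 ∂P₀ = ∫ x, s₀ x ^ 2 ∂p t₀ from
      hcomp (constVec d t₀) j (fun x => s₀ x ^ 2) hs₀.integrable_sq.aestronglyMeasurable]
    exact integral_congr_ae (by filter_upwards [hSs j] with x hx; rw [hx])
  -- the remainder tested against `G ⊗ G`
  set rem : (Fin d → X) × (Fin d → X) → ℝ := fun z =>
    likelihoodRemainder (productModel p d) (constVec d t₀) S δ z.1 z.2 with hremdef
  have hsplit : ∀ z, rem z * (G z.1 * G z.2) =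
      ((2 : ℝ) ^ d)⁻¹ * ∑ u, D u z.1 * D u z.2 -
        δ ^ 2 * ∑ i, (S z.1 i * G z.1) * (S z.2 i * G z.2) := fun z => by
    simp only [hremdef, likelihoodRemainder, hD, PiLp.inner_apply, RCLike.inner_apply,
      conj_trivial, sub_mul (_ * _)]
    rw [mul_assoc, mul_assoc, Finset.sum_mul, Finset.sum_mul]
    congr 2
    · exact Finset.sum_congr rfl fun u _ => by ring
    · exact Finset.sum_congr rfl fun i _ => by ring
  have hint1 : Integrable (fun z : (Fin d → X) × (Fin d → X) =>
      ((2 : ℝ) ^ d)⁻¹ * ∑ u, D u z.1 * D u z.2) (P₀.prod P₀) :=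
    (integrable_finsetSum _ fun u _ => (hDint u).mul_prod (hDint u)).const_mul _
  have hint2 : Integrable (fun z : (Fin d → X) × (Fin d → X) =>
      δ ^ 2 * ∑ i, (S z.1 i * G z.1) * (S z.2 i * G z.2)) (P₀.prod P₀) :=
    (integrable_finsetSum _ fun i _ => (hSG i).mul_prod (hSG i)).const_mul _
  have hval : ∫ z, rem z * (G z.1 * G z.2) ∂(P₀.prod P₀) =
      ((2 : ℝ) ^ d)⁻¹ * ∑ u : Fin d → ℤˣ, a (u j) ^ 2 -
        δ ^ 2 * ∑ i, (∫ x, S x i * G x ∂P₀) ^ 2 := by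
    simp_rw [hsplit]
    rw [integral_sub hint1 hint2, integral_const_mul, integral_const_mul,
      integral_finsetSum _ fun u _ => (hDint u).mul_prod (hDint u),
      integral_finsetSum _ fun i _ => (hSG i).mul_prod (hSG i)]
    congr 2
    · refine Finset.sum_congr rfl fun u _ => ?_
      rw [integral_prod_mul, hDval, sq]
    · refine Finset.sum_congr rfl fun i _ => ?_
      rw [integral_prod_mul (fun x => S x i * G x) (fun x => S x i * G x), sq]
  have hremm : AEStronglyMeasurable rem (P₀.prod P₀) := by
    have hS1 := hS.aestronglyMeasurable.comp_fst (ν := P₀)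
    have hS2 := hS.aestronglyMeasurable.comp_snd (ν := P₀) (μ := P₀)
    refine AEStronglyMeasurable.sub ?_ ((hS1.inner hS2).const_mul _)
    refine (Measurable.const_mul (Finset.measurable_fun_sum _ fun u _ => ?_)
      _).aestronglyMeasurable
    have hL : Measurable fun x =>
        ((productModel p d (constVec d t₀ + δ • signVec u)).rnDeriv P₀ x).toReal - 1 :=
      (Measure.measurable_rnDeriv _ _).ennreal_toReal.sub_const 1
    exact (hL.comp measurable_fst).mul (hL.comp measurable_snd)
  obtain ⟨hrem2, hremH⟩ := memLp_two_of_lintegral_sq_le hremm (sq_nonneg H) hrem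
  have hGG : MemLp (fun z : (Fin d → X) × (Fin d → X) => G z.1 * G z.2) 2 (P₀.prod P₀) := by
    refine MemLp.of_bound ((hGm.comp measurable_fst).mul
      (hGm.comp measurable_snd)).aestronglyMeasurable (M * M) (ae_of_all _ fun z => ?_)
    rw [norm_mul]
    exact mul_le_mul (hGM _) (hGM _) (norm_nonneg _) ((abs_nonneg _).trans (hGM z.1))
  have hGGsq : ∫ z, (G z.1 * G z.2) ^ 2 ∂(P₀.prod P₀) = N ^ 2 := by
    simp_rw [mul_pow]
    rw [integral_prod_mul (fun x => G x ^ 2) (fun x => G x ^ 2), hGsq, sq]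
  have hCS := (abs_le.1 (integral_mul_le_mul hrem2 hGG hH hN0 hremH hGGsq.le)).2
  have hmean := half_le_mean_sign j (fun e => a e ^ 2) fun e => sq_nonneg _
  have ha1 : a 1 = ∫ x, g x ∂p (t₀ + δ) - ∫ x, g x ∂p t₀ := by simp [ha]
  rw [← ha1]
  have := mul_le_mul_of_nonneg_left hSGsum (sq_nonneg δ)
  rw [hval] at hCS
  linarith

/-- **`χ²` bound.** Testing with the truncations `g` of the centred likelihood ratio itself, for
which the change of the mean of `g` is `∫ g²`, bounds `∫ g²` uniformly in the truncation level. -/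
theorem centredRatio_memLp_and_integral_sq_le {s₀ : X → ℝ}
    {S : (Fin d → X) → EuclideanSpace ℝ (Fin d)}
    (hs₀ : MemLp s₀ 2 (p t₀)) (hs₀0 : ∫ x, s₀ x ∂p t₀ = 0)
    (hS : MemLp S 2 (productModel p d (constVec d t₀)))
    (hSs : ∀ i, (fun x => S x i) =ᵐ[productModel p d (constVec d t₀)] fun x => s₀ (x i))
    {δ H : ℝ} (hH : 0 ≤ H)
    (hac : ∀ u : Fin d → ℤˣ,
      productModel p d (constVec d t₀ + δ • signVec u) ≪ productModel p d (constVec d t₀))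
    (hac₁ : p (t₀ + δ) ≪ p t₀)
    (hrem : ∫⁻ z, ENNReal.ofReal
        (likelihoodRemainder (productModel p d) (constVec d t₀) S δ z.1 z.2 ^ 2)
        ∂((productModel p d (constVec d t₀)).prod (productModel p d (constVec d t₀))) ≤
      ENNReal.ofReal (H ^ 2))
    (j : Fin d) :
    MemLp (centredRatio (p t₀) (p (t₀ + δ))) 2 (p t₀) ∧
      ∫ x, centredRatio (p t₀) (p (t₀ + δ)) x ^ 2 ∂p t₀ ≤
        2 * (δ ^ 2 * fisherInfo (p t₀) s₀ + H) := by
  set f := centredRatio (p t₀) (p (t₀ + δ)) with hf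
  have hfm : Measurable f := measurable_centredRatio _ _
  set K := 2 * (δ ^ 2 * fisherInfo (p t₀) s₀ + H) with hK
  have hI0 : 0 ≤ fisherInfo (p t₀) s₀ := integral_nonneg fun x => sq_nonneg _
  have hK0 : 0 ≤ K := by positivity
  refine memLp_two_of_lintegral_sq_le hfm.aestronglyMeasurable hK0 ?_
  set A : ℕ → Set X := fun m => {x | |f x| ≤ m} with hA
  have hAm : ∀ m, MeasurableSet (A m) := fun m => measurableSet_le hfm.abs measurable_const
  have hbound : ∀ m, ∫⁻ x in A m, ENNReal.ofReal (f x ^ 2) ∂p t₀ ≤ ENNReal.ofReal K := fun m => by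
    set g : X → ℝ := (A m).indicator f with hg
    have hgm : Measurable g := hfm.indicator (hAm m)
    have hgM : ∀ x, |g x| ≤ m := fun x => by
      by_cases hx : x ∈ A m
      · rw [hg, Set.indicator_of_mem hx]; exact hx
      · rw [hg, Set.indicator_of_notMem hx]; simp
    have hfg : ∀ x, f x * g x = g x ^ 2 := fun x => by
      by_cases hx : x ∈ A m
      · rw [hg, Set.indicator_of_mem hx, sq]
      · rw [hg, Set.indicator_of_notMem hx]; simp
    have hmain := half_sq_integral_sub_le hs₀ hs₀0 hS hSs hH hac hrem j hgm hgM
    rw [← (integral_rnDeriv_sub_one_mul hac₁ hgm hgM).2] at hmain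
    have hfg' : ∫ x, (((p (t₀ + δ)).rnDeriv (p t₀) x).toReal - 1) * g x ∂p t₀ =
        ∫ x, g x ^ 2 ∂p t₀ := integral_congr_ae (ae_of_all _ hfg)
    rw [hfg'] at hmain
    have hN0 : 0 ≤ ∫ x, g x ^ 2 ∂p t₀ := integral_nonneg fun x => sq_nonneg _
    have hN : ∫ x, g x ^ 2 ∂p t₀ ≤ K := by
      rcases hN0.eq_or_lt with h | h
      · rw [← h]; exact hK0
      · refine le_of_mul_le_mul_right ?_ h
        rw [hK]; linarith
    have hg2 : MemLp g 2 (p t₀) :=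
      MemLp.of_bound hgm.aestronglyMeasurable m (ae_of_all _ fun x => hgM x)
    rw [← lintegral_indicator (hAm m)]
    have : ∀ x, (A m).indicator (fun x => ENNReal.ofReal (f x ^ 2)) x =
        ENNReal.ofReal (g x ^ 2) := fun x => by
      by_cases hx : x ∈ A m
      · rw [hg, Set.indicator_of_mem hx, Set.indicator_of_mem hx]
      · rw [hg, Set.indicator_of_notMem hx, Set.indicator_of_notMem hx]; simp
    simp_rw [this]
    rw [← ofReal_integral_eq_lintegral_ofReal hg2.integrable_sq (ae_of_all _ fun x => sq_nonneg _)]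
    exact ENNReal.ofReal_le_ofReal hN
  have hmono : Monotone A := fun m m' hmm x hx =>
    (show |f x| ≤ m from hx).trans (by exact_mod_cast hmm)
  have hunion : ⋃ m, A m = Set.univ := Set.eq_univ_of_forall fun x => by
    obtain ⟨m, hm⟩ := exists_nat_ge |f x|
    exact Set.mem_iUnion.2 ⟨m, hm⟩
  rw [← setLIntegral_univ, ← hunion, setLIntegral_iUnion_of_directed _ hmono.directed_le]
  exact iSup_le hbound

end ChiSquare

/-! ### The minimax lower bound -/

section Minimax

variable {X : Type v} [MeasurableSpace X] {p : ℝ → Measure X} {d : ℕ} {t₀ : ℝ}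

/-- The parameter whose coordinates are `t₀ + δ` where `u` is true and `t₀` elsewhere. -/
noncomputable def hypercubePoint (t₀ δ : ℝ) (u : Fin d → Bool) : EuclideanSpace ℝ (Fin d) :=
  WithLp.toLp 2 fun j => if u j then t₀ + δ else t₀

theorem productModel_hypercubePoint (δ : ℝ) (u : Fin d → Bool) :
    productModel p d (hypercubePoint t₀ δ u) = hypercubeLaw (p t₀) (p (t₀ + δ)) u := by
  simp only [productModel, hypercubeLaw, hypercubePoint]
  congr 1
  funext i
  split_ifs <;> rfl

theorem hypercubePoint_mem_cube {δ : ℝ} (hδ : 0 ≤ δ) (u : Fin d → Bool) :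
    hypercubePoint t₀ δ u ∈ cube (constVec d t₀) δ := fun i => by
  simp only [hypercubePoint, constVec]
  split_ifs
  · rw [add_sub_cancel_left, abs_of_nonneg hδ]
  · simpa using hδ

theorem enorm_sub_sq_mul_prod_eq_ofReal {n : ℕ} {Ω : Type*} [MeasurableSpace Ω] (μ : Measure Ω)
    [IsFiniteMeasure μ] (v θ : EuclideanSpace ℝ (Fin d)) (A : Fin n → Set Ω) :
    ‖v - θ‖ₑ ^ 2 * ∏ i, μ (A i) =
      ENNReal.ofReal ((∑ j, (v j - θ j) ^ 2) * ∏ i, μ.real (A i)) := by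
  have h1 : ‖v - θ‖ₑ ^ 2 = ENNReal.ofReal (∑ j, (v j - θ j) ^ 2) := by
    rw [← ofReal_norm, ← ENNReal.ofReal_pow (norm_nonneg _), EuclideanSpace.real_norm_sq_eq]
    rfl
  rw [h1, ENNReal.ofReal_mul (Finset.sum_nonneg fun j _ => sq_nonneg _),
    ENNReal.ofReal_prod_of_nonneg fun i _ => measureReal_nonneg]
  congr 1
  exact Finset.prod_congr rfl fun i _ => (ofReal_measureReal).symm

variable [∀ t, IsProbabilityMeasure (p t)]

/-- Averaging over the vertices of the hypercube and over the public randomness. -/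
theorem ofReal_le_minimaxRisk {δ : ℝ} (hac : p (t₀ + δ) ≪ p t₀) {κ : ℝ} (hκ : 0 < κ)
    (hL2 : MemLp (centredRatio (p t₀) (p (t₀ + δ))) 2 (p t₀))
    (hnorm : ∫ x, centredRatio (p t₀) (p (t₀ + δ)) x ^ 2 ∂p t₀ ≤ κ)
    {n k : ℕ} (hinfo : n * (κ * min ((2 : ℝ) ^ k) d) ≤ d / 32)
    {Θ : Set (EuclideanSpace ℝ (Fin d))} (hΘ : ∀ u, hypercubePoint t₀ δ u ∈ Θ) :
    ENNReal.ofReal (δ ^ 2 * d / 32) ≤ minimaxRisk.{v, w} n k (productModel p d) Θ := by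
  refine le_iInf fun pr => le_iInf fun θhat => le_iInf fun hθ => ?_
  set s := ⨆ θ ∈ Θ, pr.risk (productModel p d) θhat θ with hs
  have hrisk := fun u : Fin d → Bool =>
    pr.risk_eq_lintegral_sum (productModel p d) hθ (hypercubePoint t₀ δ u)
  have hupper : ∑ u : Fin d → Bool, pr.risk (productModel p d) θhat (hypercubePoint t₀ δ u) ≤
      2 ^ d * s := by
    refine (Finset.sum_le_sum fun u _ =>
      le_iSup₂ (f := fun θ (_ : θ ∈ Θ) => pr.risk (productModel p d) θhat θ) _ (hΘ u)).trans_eq ?_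
    simp [hs]
  have hlower : ENNReal.ofReal (2 ^ d * (δ ^ 2 * d / 32)) ≤
      ∑ u : Fin d → Bool, pr.risk (productModel p d) θhat (hypercubePoint t₀ δ u) := by
    rw [Finset.sum_congr rfl fun u _ => (hrisk u).2, ← lintegral_finsetSum _ fun u _ => (hrisk u).1]
    refine le_trans (le_of_eq ?_) (lintegral_mono (f := fun _ =>
      ENNReal.ofReal (2 ^ d * (δ ^ 2 * d / 32))) fun r => ?_)
    · simp
    · simp_rw [enorm_sub_sq_mul_prod_eq_ofReal, productModel_hypercubePoint]
      have hnn : ∀ (u : Fin d → Bool) (y : Fin (n * k) → Bool),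
          0 ≤ (∑ j, (θhat r (List.ofFn y) j - hypercubePoint t₀ δ u j) ^ 2) *
            ∏ i, (hypercubeLaw (p t₀) (p (t₀ + δ)) u).real
              (answerSet (pr.label r) (pr.bit r) i (List.ofFn y)) := fun u y =>
        mul_nonneg (Finset.sum_nonneg fun j _ => sq_nonneg _)
          (Finset.prod_nonneg fun i _ => measureReal_nonneg)
      simp_rw [← ENNReal.ofReal_sum_of_nonneg fun y _ => hnn _ y]
      rw [← ENNReal.ofReal_sum_of_nonneg fun u _ => Finset.sum_nonneg fun y _ => hnn u y]
      exact ENNReal.ofReal_le_ofReal (sum_sq_error_hypercubeLaw_ge hac hκ hL2 hnorm hinfo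
        (pr.label r) (pr.bit r) (fun v => (pr.measurable_bit v).comp measurable_prodMk_left)
        (pr.budget r) (fun y j => θhat r (List.ofFn y) j) t₀ δ)
  have h := hlower.trans hupper
  rw [ENNReal.ofReal_mul (by positivity), ENNReal.ofReal_pow (by norm_num),
    ENNReal.ofReal_ofNat] at h
  exact (ENNReal.mul_le_mul_iff_right (by positivity) (by finiteness)).1 h

end Minimax

section Fisher

variable {d : ℕ} {Ω : Type*} [MeasurableSpace Ω]

theorem iSup_fisherMatrix_diag_pos {μ : Measure Ω} {S : Ω → EuclideanSpace ℝ (Fin d)} (hd : 1 ≤ d)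
    (hS : MemLp S 2 μ) (hdet : IsUnit (fisherMatrix μ S).det) :
    0 < ⨆ i, fisherMatrix μ S i i := by
  by_contra! hneg
  let i : Fin d := ⟨0, hd⟩
  have hSi : MemLp (fun x => S x i) 2 μ :=
    (EuclideanSpace.proj (𝕜 := ℝ) i : EuclideanSpace ℝ (Fin d) →L[ℝ] ℝ).comp_memLp' hS
  have hle : fisherMatrix μ S i i ≤ 0 :=
    (le_ciSup (f := fun i => fisherMatrix μ S i i) (Set.finite_range _).bddAbove i).trans hneg
  simp only [fisherMatrix, Matrix.of_apply, ← sq] at hle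
  have h0 := (integral_eq_zero_iff_of_nonneg (fun x => sq_nonneg (S x i)) hSi.integrable_sq).1
    (le_antisymm hle (integral_nonneg fun x => sq_nonneg _))
  refine hdet.ne_zero (Matrix.det_eq_zero_of_row_eq_zero i fun j => ?_)
  simp only [fisherMatrix, Matrix.of_apply]
  refine integral_eq_zero_of_ae ?_
  filter_upwards [h0] with x hx
  simp [(pow_eq_zero_iff two_ne_zero).1 hx]

end Fisher

/-- The choice `δ² = a d / (n m I)` of the perturbation size, where `m = min (2 ^ k) d`, meets the
size constraints and keeps the total information `n m κ` below `d / 32`. -/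
theorem exists_perturbation_size {δ₀ c₀ ρ a d n m I : ℝ} (hδ₀ : 0 < δ₀) (hc₀ : 0 < c₀)
    (hρ : 0 < ρ) (ha : 0 < a) (ha1 : a ≤ 1) (haρ : a ≤ ρ ^ 2) (haδ : a ≤ δ₀ ^ 2 / 2)
    (hac : a ≤ 1 / (64 * (1 + c₀))) (hd : 1 ≤ d) (hm : 0 < m) (hI : 0 < I) (hn : 0 < n)
    (hnm : d ^ 2 / m ≤ n) :
    ∃ δ : ℝ, 0 < δ ∧ δ ^ 2 = a * d / (n * m * I) ∧ δ ≤ ρ / √(d * I) ∧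
      δ < δ₀ * (I ^ 2 * d) ^ (-(1 / 4) : ℝ) ∧
      n * (2 * (δ ^ 2 * I + c₀ * δ ^ 4 * I ^ 2 * d) * m) ≤ d / 32 := by
  have hd0 : 0 < d := by linarith
  have hnm' : d ^ 2 ≤ n * m := (div_le_iff₀ hm).1 hnm
  have hq : 0 < a * d / (n * m * I) := by positivity
  set δ := √(a * d / (n * m * I)) with hδ
  have hδ2 : δ ^ 2 = a * d / (n * m * I) := Real.sq_sqrt hq.le
  have hδpos : 0 < δ := Real.sqrt_pos.2 hq
  -- The two scale-free consequences of `d² ≤ n m`.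
  have h1 : δ ^ 2 * (d * I) ≤ a := by
    rw [hδ2, div_mul_eq_mul_div, div_le_iff₀ (by positivity)]
    nlinarith [mul_le_mul_of_nonneg_left hnm' (mul_pos ha hI).le]
  have h2 : δ ^ 2 * I * (n * m) = a * d := by
    rw [hδ2]; field_simp
  refine ⟨δ, hδpos, hδ2, ?_, ?_, ?_⟩
  · rw [le_div_iff₀ (by positivity)]
    refine le_of_abs_le (abs_le_of_sq_le_sq ?_ hρ.le)
    rw [mul_pow, Real.sq_sqrt (show 0 ≤ d * I by positivity)]
    exact h1.trans haρ
  · have hT : 0 < I ^ 2 * d := by positivity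
    refine lt_of_pow_lt_pow_left₀ 4 (by positivity) ?_
    have hpow : ((I ^ 2 * d) ^ (-(1 / 4) : ℝ)) ^ 4 = (I ^ 2 * d)⁻¹ := by
      rw [← Real.rpow_natCast, ← Real.rpow_mul hT.le, ← Real.rpow_neg_one]
      norm_num
    rw [mul_pow, hpow, ← div_eq_mul_inv, lt_div_iff₀ hT]
    have h3 : δ ^ 4 * (I ^ 2 * d) ≤ (δ ^ 2 * (d * I)) ^ 2 := by
      have : (δ ^ 2 * (d * I)) ^ 2 = δ ^ 4 * (I ^ 2 * d) * d := by ring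
      rw [this]
      exact le_mul_of_one_le_right (by positivity) hd
    have h4 : (δ ^ 2 * (d * I)) ^ 2 ≤ a ^ 2 := pow_le_pow_left₀ (by positivity) h1 2
    have h5 : a ^ 2 < δ₀ ^ 4 := by
      have : a ^ 2 ≤ (δ₀ ^ 2 / 2) ^ 2 := pow_le_pow_left₀ ha.le haδ 2
      nlinarith [pow_pos hδ₀ 4]
    linarith
  · have h6 : δ ^ 4 * I ^ 2 * d * (n * m) ≤ a * d * a := by
      have : δ ^ 4 * I ^ 2 * d * (n * m) = (δ ^ 2 * I * (n * m)) * (δ ^ 2 * (d * I)) := by ring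
      rw [this, h2]
      exact mul_le_mul_of_nonneg_left h1 (by positivity)
    have h7 : a * (64 * (1 + c₀)) ≤ 1 := (le_div_iff₀ (by positivity)).1 hac
    have h8 : n * (2 * (δ ^ 2 * I + c₀ * δ ^ 4 * I ^ 2 * d) * m) =
        2 * (δ ^ 2 * I * (n * m)) + 2 * c₀ * (δ ^ 4 * I ^ 2 * d * (n * m)) := by ring
    rw [h8, h2]
    have h9 : 2 * c₀ * (δ ^ 4 * I ^ 2 * d * (n * m)) ≤ 2 * c₀ * (a * d * 1) :=
      mul_le_mul_of_nonneg_left (h6.trans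
        (mul_le_mul_of_nonneg_left ha1 (by positivity))) (by positivity)
    nlinarith

theorem theorem1 (δ₀ c₀ ρ : ℝ) (hδ₀ : 0 < δ₀) (hc₀ : 0 < c₀) (hρ : 0 < ρ) :
    ∃ C : ℝ, 0 < C ∧
      ∀ (d : ℕ), 1 ≤ d →
      ∀ (X : Type v) [MeasurableSpace X] (p : ℝ → Measure X) [∀ t, IsProbabilityMeasure (p t)]
        (Θ : Set (EuclideanSpace ℝ (Fin d))) (t₀ : ℝ)
        (s₀ : X → ℝ) (S : (Fin d → X) → EuclideanSpace ℝ (Fin d)),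
        -- `s₀` is the score of the one-dimensional model at `t₀`
        DiffInQuadraticMean p Set.univ t₀ s₀ →
        -- the parameter set contains a cube around `(t₀, …, t₀)`
        cube (constVec d t₀) (ρ / √(d * fisherInfo (p t₀) s₀)) ⊆ Θ →
        -- the product model is differentiable in quadratic mean, with non-singular information
        DiffInQuadraticMean (productModel p d) Θ (constVec d t₀) S →
        IsUnit (fisherMatrix (productModel p d (constVec d t₀)) S).det →
        -- the second-order remainder bound
        RemainderBound (productModel p d) Θ (constVec d t₀) S δ₀ c₀ →
        ProbabilityTheory.variance s₀ (p t₀) = fisherInfo (p t₀) s₀ ∧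
        ∀ (n k : ℕ), (d : ℝ) ^ 2 / min ((2 : ℝ) ^ k) d ≤ n →
          ENNReal.ofReal
              (C * ((d : ℝ) ^ 2 / (n * min ((2 : ℝ) ^ k) d * fisherInfo (p t₀) s₀)))
            ≤ minimaxRisk.{v, w} n k (productModel p d) Θ := by
  obtain ⟨a, ha, ha1, haρ, haδ, hac⟩ : ∃ a : ℝ, 0 < a ∧ a ≤ 1 ∧ a ≤ ρ ^ 2 ∧ a ≤ δ₀ ^ 2 / 2 ∧
      a ≤ 1 / (64 * (1 + c₀)) := by
    refine ⟨min (min 1 (ρ ^ 2)) (min (δ₀ ^ 2 / 2) (1 / (64 * (1 + c₀)))), ?_, ?_, ?_, ?_, ?_⟩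
    · positivity
    · exact (min_le_left _ _).trans (min_le_left _ _)
    · exact (min_le_left _ _).trans (min_le_right _ _)
    · exact (min_le_right _ _).trans (min_le_left _ _)
    · exact (min_le_right _ _).trans (min_le_right _ _)
  refine ⟨a / 32, by positivity, ?_⟩
  intro d hd X _ p _ Θ t₀ s₀ S h₀ hcube h hdet hrem
  have hs₀ : ∫ x, s₀ x ∂p t₀ = 0 := h₀.integral_score_eq_zero
  refine ⟨ProbabilityTheory.variance_of_integral_eq_zero
    h₀.1.aestronglyMeasurable.aemeasurable hs₀, fun n k hn => ?_⟩
  have hI0 : 0 ≤ fisherInfo (p t₀) s₀ := integral_nonneg fun x => sq_nonneg _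
  -- For vanishing information the left-hand side is zero by the convention `x / 0 = 0`.
  rcases hI0.eq_or_lt with hI | hI
  · rw [← hI]; simp
  have hd1 : (1 : ℝ) ≤ d := by exact_mod_cast hd
  have hm : 0 < min ((2 : ℝ) ^ k) d := lt_min (by positivity) (by linarith)
  have hn0 : (0 : ℝ) < n := lt_of_lt_of_le (by positivity) hn
  set I := fisherInfo (p t₀) s₀ with hIdef
  set P₀ := productModel p d (constVec d t₀) with hP₀
  set B := ⨆ i, fisherMatrix P₀ S i i with hB
  have hBpos : 0 < B := iSup_fisherMatrix_diag_pos hd h.1 hdet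
  let j : Fin d := ⟨0, hd⟩
  have hac₁ : ∀ δ, (∀ u : Fin d → ℤˣ, productModel p d (constVec d t₀ + δ • signVec u) ≪ P₀) →
      p (t₀ + δ) ≪ p t₀ := fun δ hδ => by
    have := absolutelyContinuous_of_productModel (hδ 1) j
    rw [constVec_add_smul_signVec_apply] at this
    simpa [constVec] using this
  set r := min (ρ / √(d * I)) (δ₀ * (B ^ 2 * d) ^ (-(1 / 4) : ℝ)) with hr
  have hrpos : 0 < r := lt_min (by positivity) (by positivity)
  have hcube_mono : ∀ δ, δ ≤ ρ / √(d * I) → cube (constVec d t₀) δ ⊆ Θ := fun δ hδ θ hθ =>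
    hcube fun i => (hθ i).trans hδ
  have hSs := h₀.score_ae_eq h hrpos (hcube_mono r (min_le_left _ _)) fun δ hδ hδr =>
    hac₁ δ (hrem B rfl δ hδ (hcube_mono δ (hδr.le.trans (min_le_left _ _)))
      (hδr.trans_le (min_le_right _ _))).1
  have hdiag : ∀ i, fisherMatrix P₀ S i i = I := fun i => by
    simp only [fisherMatrix, Matrix.of_apply, ← sq, hIdef, fisherInfo]
    refine (integral_congr_ae ?_).trans (integral_comp_eval (μ := fun i => p (constVec d t₀ i))
      (i := i) (f := fun x => s₀ x ^ 2) h₀.1.integrable_sq.aestronglyMeasurable)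
    filter_upwards [hSs i] with x hx
    rw [hx]
  have hBI : B = I := by
    have : Nonempty (Fin d) := ⟨j⟩
    rw [hB, iSup_congr hdiag, ciSup_const]
  obtain ⟨δ, hδ, hδ2, hδρ, hδδ, hinfo⟩ := exists_perturbation_size hδ₀ hc₀ hρ ha ha1 haρ haδ hac
    hd1 hm hI hn0 hn
  obtain ⟨hacδ, hremδ⟩ := hrem B rfl δ hδ (hcube_mono δ hδρ) (by rw [hBI]; exact hδδ)
  obtain ⟨hL2, hnorm⟩ := centredRatio_memLp_and_integral_sq_le h₀.1 hs₀ h.1 hSs (by positivity)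
    hacδ (hac₁ δ hacδ) hremδ j
  rw [hBI, ← hIdef] at hnorm
  have hmain := ofReal_le_minimaxRisk.{v, w} (hac₁ δ hacδ) (by positivity) hL2 hnorm hinfo
    (Θ := Θ) fun u => hcube_mono δ hδρ (hypercubePoint_mem_cube hδ.le u)
  refine le_trans (le_of_eq ?_) hmain
  rw [hδ2]
  congr 1
  ring
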